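/- Graphs are finite multigraphs (parallel edges and self-loops allowed), and all polynomials have rational coefficients and one variable $x_f$ per edge $f$. The Kirchhoff polynomial of a graph $G$ is $\Psi_G=\sum_T\prod_{f\notin T}x_f$, the sum over all spanning trees $T$ of $G$ (so $\Psi_G=0$ if $G$ is disconnected). For an edge $e$ of $G$, condition 1, written $1(G,e)$, says that $\Psi_G$ lies in the ideal generated by the partial derivatives of $\Psi_{G\setminus e}$. A source-terminal graph is a graph with two distinct marked vertices, the source $s$ and the terminal $t$. The parallel join $G\star H$ is the disjoint union of $G$ and $H$ with the two sources identified and the two terminals identified; the series join is the disjoint union of $G$ and $H$ with the terminal of $G$ identified with the source of $H$, with source that of $G$ and terminal that of $H$. The series-parallel graphs are the source-terminal graphs that arise (up to isomorphism) from $K_2$, with its two vertices as source and terminal, by parallel and series joins. For a source-terminal graph $G$ let $P_G$ be the Kirchhoff polynomial of the graph obtained from $G$ by identifying $s$ and $t$. Simultaneous combination $S(G,e)$ holds if there are polynomials $A_j$ (for the edges $j$ of $G$), $B$ and $C$ with $$\Psi_G=\sum_j A_j\,\partial_j\partial_e\Psi_G+B\,\partial_e\Psi_G,\qquad P_G=\sum_j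 A_j\,\partial_j\partial_e P_G+C\,\partial_e P_G .$$ Corollary. Let $G$ be a series-parallel graph and $e$ an edge of $G$ such that $1(G,e)$ holds. (i) If $S(G,e)$ does not hold, then there is a series-parallel graph $H$ such that $1(G\star H,e)$ fails. (ii) Consequently simultaneous combination characterizes when condition 1 is stable under parallel join: $S(G,e)$ holds if and only if $1(G\star H,e)$ holds for every series-parallel graph $H$. -/

import Mathlib

universe u v

/-! Connectivity, trees and Kirchhoff polynomials of multigraphs.  A multigraph is Mathlib's
`Graph α β`: a vertex set in the type `α`, an edge set in the type `β`; loops and parallel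
edges are allowed. -/

namespace Kirchhoff

open MvPolynomial

/-- Two vertices are joined by a (possibly trivial) walk. -/
def Reachable {α : Type u} {β : Type v} (G : Graph α β) (x y : α) : Prop :=
  Relation.ReflTransGen G.Adj x y

/-- A connected multigraph (in particular it has a vertex). -/
def IsConnected {α : Type u} {β : Type v} (G : Graph α β) : Prop :=
  G.vertexSet.Nonempty ∧ ∀ x ∈ G.vertexSet, ∀ y ∈ G.vertexSet, Reachable G x y

/-- A multigraph without cycles: no edge lies on a cycle, that is, the two ends of an edge are
never joined by a walk that avoids this edge.  (A loop is a cycle, and so is a pair of parallel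
edges.) -/
def IsAcyclic {α : Type u} {β : Type v} (G : Graph α β) : Prop :=
  ∀ e x y, G.IsLink e x y → ¬ Reachable (G.deleteEdges {e}) x y

/-- `T` is the edge set of a spanning tree of `G`. (`G.restrict T` is the subgraph with all the
vertices of `G` and with the edges in `T`.) -/
def IsSpanningTree {α : Type u} {β : Type v} (G : Graph α β) (T : Set β) : Prop :=
  T ⊆ G.edgeSet ∧ IsConnected (G.restrict T) ∧ IsAcyclic (G.restrict T)

open Classical in
/-- The Kirchhoff polynomial `Ψ_G = ∑_T ∏_{e ∉ T} x_e`, the sum over the spanning trees of `G`,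
with rational coefficients. -/
noncomputable def kirchhoff {α : Type u} {β : Type v} [Fintype β] (G : Graph α β) :
    MvPolynomial β ℚ :=
  ∑ T : Finset β with IsSpanningTree G (T : Set β), ∏ e with e ∈ G.edgeSet ∧ e ∉ T, X e

/-- The Jacobian ideal of `f`: the ideal generated by its partial derivatives. -/
noncomputable def jacobianIdeal {β : Type v} (f : MvPolynomial β ℚ) : Ideal (MvPolynomial β ℚ) :=
  Ideal.span (Set.range fun j : β => pderiv j f)

/-- Aluffi's condition 1 for the edge `e` of `G`: the Kirchhoff polynomial of `G` lies in the
Jacobian ideal of the Kirchhoff polynomial of `G` with `e` deleted. -/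
def Condition1 {α : Type u} {β : Type v} [Fintype β] (G : Graph α β) (e : β) : Prop :=
  kirchhoff G ∈ jacobianIdeal (kirchhoff (G.deleteEdges {e}))

/-- The disjoint union of two multigraphs. -/
def disjointUnion {α α' : Type u} {β β' : Type v} (G : Graph α β) (H : Graph α' β') :
    Graph (α ⊕ α') (β ⊕ β') where
  vertexSet := Sum.inl '' G.vertexSet ∪ Sum.inr '' H.vertexSet
  edgeSet := Sum.inl '' G.edgeSet ∪ Sum.inr '' H.edgeSet
  IsLink := Sum.elim (fun e => Relation.Map (G.IsLink e) Sum.inl Sum.inl)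
    (fun e => Relation.Map (H.IsLink e) Sum.inr Sum.inr)
  isLink_symm := by
    rintro (e | e) -
    · refine ⟨?_⟩
      rintro _ _ ⟨a, b, h, rfl, rfl⟩
      exact ⟨b, a, h.symm, rfl, rfl⟩
    · refine ⟨?_⟩
      rintro _ _ ⟨a, b, h, rfl, rfl⟩
      exact ⟨b, a, h.symm, rfl, rfl⟩
  eq_or_eq_of_isLink_of_isLink := by
    rintro (e | e) _ _ _ _ ⟨a, b, h, rfl, rfl⟩ ⟨c, d, h', rfl, rfl⟩
    · obtain rfl | rfl := h.left_eq_or_eq h' <;> simp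
    · obtain rfl | rfl := h.left_eq_or_eq h' <;> simp
  edge_mem_iff_exists_isLink := by
    rintro (e | e)
    · constructor
      · rintro (⟨e', he, h⟩ | ⟨e', he, h⟩)
        · cases h
          obtain ⟨x, y, hxy⟩ := Graph.exists_isLink_of_mem_edgeSet he
          exact ⟨_, _, x, y, hxy, rfl, rfl⟩
        · cases h
      · rintro ⟨_, _, x, y, h, -, -⟩
        exact Or.inl ⟨e, h.edge_mem, rfl⟩
    · constructor
      · rintro (⟨e', he, h⟩ | ⟨e', he, h⟩)
        · cases h
        · cases h
          obtain ⟨x, y, hxy⟩ := Graph.exists_isLink_of_mem_edgeSet he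
          exact ⟨_, _, x, y, hxy, rfl, rfl⟩
      · rintro ⟨_, _, x, y, h, -, -⟩
        exact Or.inr ⟨e, h.edge_mem, rfl⟩
  left_mem_of_isLink := by
    rintro (e | e) _ _ ⟨x, y, h, rfl, rfl⟩
    · exact Or.inl ⟨x, h.left_mem, rfl⟩
    · exact Or.inr ⟨x, h.left_mem, rfl⟩

/-- A source-terminal graph: a multigraph with two distinct marked vertices. -/
structure STGraph (α : Type u) (β : Type v) extends Graph α β where
  source : α
  terminal : α
  source_mem : source ∈ vertexSet
  terminal_mem : terminal ∈ vertexSet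
  source_ne_terminal : source ≠ terminal

namespace STGraph

open Classical in
/-- The parallel join `G ⋆ H`: in the disjoint union, the source of `H` is identified with the
source of `G` and the terminal of `H` with the terminal of `G`.  An edge `e` of `G` becomes the
edge `Sum.inl e`. -/
noncomputable def parallelJoin {α α' : Type u} {β β' : Type v}
    (G : STGraph α β) (H : STGraph α' β') : STGraph (α ⊕ α') (β ⊕ β') where
  toGraph := (disjointUnion G.toGraph H.toGraph).map fun v =>
    if v = Sum.inr H.source then Sum.inl G.source
    else if v = Sum.inr H.terminal then Sum.inl G.terminal
    else v
  source := Sum.inl G.source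
  terminal := Sum.inl G.terminal
  source_mem := ⟨Sum.inl G.source, Or.inl ⟨_, G.source_mem, rfl⟩, by simp⟩
  terminal_mem := ⟨Sum.inl G.terminal, Or.inl ⟨_, G.terminal_mem, rfl⟩, by simp⟩
  source_ne_terminal := by simpa using G.source_ne_terminal

open Classical in
/-- The series join of `G` and `H`: in the disjoint union, the source of `H` is identified with
the terminal of `G`. -/
noncomputable def seriesJoin {α α' : Type u} {β β' : Type v}
    (G : STGraph α β) (H : STGraph α' β') : STGraph (α ⊕ α') (β ⊕ β') where
  toGraph := (disjointUnion G.toGraph H.toGraph).map fun v =>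
    if v = Sum.inr H.source then Sum.inl G.terminal else v
  source := Sum.inl G.source
  terminal := Sum.inr H.terminal
  source_mem := ⟨Sum.inl G.source, Or.inl ⟨_, G.source_mem, rfl⟩, by simp⟩
  terminal_mem := ⟨Sum.inr H.terminal, Or.inr ⟨_, H.terminal_mem, rfl⟩, by
    simpa using H.source_ne_terminal.symm⟩
  source_ne_terminal := by simp

/-- Isomorphism of source-terminal graphs: bijections between the vertex sets and between the
edge sets which preserve incidence, source and terminal. -/
def Iso {α α' : Type u} {β β' : Type v} (G : STGraph α β) (H : STGraph α' β') : Prop :=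
  ∃ (f : α → α') (g : β → β'),
    Set.BijOn f G.vertexSet H.vertexSet ∧ Set.BijOn g G.edgeSet H.edgeSet ∧
    (∀ e x y, G.IsLink e x y → H.IsLink (g e) (f x) (f y)) ∧
    f G.source = H.source ∧ f G.terminal = H.terminal

/-- `G` is `K₂`: the source, the terminal and a single edge joining them. -/
def IsK2 {α : Type u} {β : Type v} (G : STGraph α β) : Prop :=
  G.vertexSet = {G.source, G.terminal} ∧
    ∃ e, G.edgeSet = {e} ∧ G.IsLink e G.source G.terminal

/-- Series-parallel graphs: the source-terminal graphs obtained from `K₂` by parallel and series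
joins, up to isomorphism. -/
inductive IsSeriesParallel :
    {α : Type u} → {β : Type v} → STGraph α β → Prop
  | k2 {α : Type u} {β : Type v} {G : STGraph α β} : IsK2 G → IsSeriesParallel G
  | parallel {α α' : Type u} {β β' : Type v} {G : STGraph α β} {H : STGraph α' β'} :
      IsSeriesParallel G → IsSeriesParallel H → IsSeriesParallel (parallelJoin G H)
  | series {α α' : Type u} {β β' : Type v} {G : STGraph α β} {H : STGraph α' β'} :
      IsSeriesParallel G → IsSeriesParallel H → IsSeriesParallel (seriesJoin G H)
  | iso {α α' : Type u} {β β' : Type v} {G : STGraph α β} {H : STGraph α' β'} :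
      IsSeriesParallel G → Iso G H → IsSeriesParallel H

/-- The Kirchhoff polynomial `Ψ_G` of a source-terminal graph. -/
noncomputable def psi {α : Type u} {β : Type v} [Fintype β] (G : STGraph α β) :
    MvPolynomial β ℚ :=
  kirchhoff G.toGraph

open Classical in
/-- `P_G`: the Kirchhoff polynomial of `G` with source and terminal identified. -/
noncomputable def breaker {α : Type u} {β : Type v} [Fintype β] (G : STGraph α β) :
    MvPolynomial β ℚ :=
  kirchhoff (G.toGraph.map fun v => if v = G.terminal then G.source else v)

/-- Simultaneous combination `S(G, e)`: with the same coefficients `A_j`,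
`Ψ_G = ∑ A_j ∂_j ∂_e Ψ_G + B ∂_e Ψ_G` and `P_G = ∑ A_j ∂_j ∂_e P_G + C ∂_e P_G`.
(The terms with `j = e` or with `j` not an edge vanish.) -/
def SimultaneousCombination {α : Type u} {β : Type v} [Fintype β] (G : STGraph α β) (e : β) :
    Prop :=
  ∃ (A : β → MvPolynomial β ℚ) (B C : MvPolynomial β ℚ),
    psi G = ∑ j, A j * pderiv j (pderiv e (psi G)) + B * pderiv e (psi G) ∧
    breaker G = ∑ j, A j * pderiv j (pderiv e (breaker G)) + C * pderiv e (breaker G)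

end STGraph

end Kirchhoff

/-! Everything rests on Ψ_{G⋆H} = Ψ_G P_H + P_G Ψ_H (`psi_parallelJoin`), where the variables of G
and of H are disjoint. Since Ψ_{G∖e} = ∂_eΨ_G (`kirchhoff_deleteEdges`), condition 1 for G ⋆ H says
that this sum lies in the Jacobian ideal J of F = ∂_eΨ_G · P_H + ∂_eP_G · Ψ_H.

Given a simultaneous combination, ∑ A_j ∂_jF is the desired sum up to multiples of the two summands
of F. Euler's identity in the variables of G alone and in those of H alone gives two relations
modulo J between these summands. Their determinant is a nonzero integer, because P has degree one
more than Ψ, so both summands lie in J (`mem_jacobianIdeal_of_combination`). The degrees come from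
`IsSeriesParallel.exists_isBalanced`.

Conversely, one test graph H serves for every G: two double edges in series (`doubleDigon`).
Membership in J becomes an identity of polynomials in the four variables of H over the polynomial
ring of G. The constant terms of the coefficients of the ∂_jF, j an edge of G, are the A_j, and
comparing six coefficients gives both identities of S(G, e) (`combination_of_coeff`).

Condition 1 for G itself enters only through ∂_eΨ_G ≠ 0 (`pderiv_psi_ne_zero`). -/

namespace Kirchhoff

open MvPolynomial

/-! ### Walks, forests and the identification of two vertices -/

section Conn

variable {α α' : Type u} {β β' : Type v}

/-- Two vertices are joined by a walk whose edges lie in `T`. -/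
def Conn (G : Graph α β) (T : Set β) : α → α → Prop :=
  Relation.ReflTransGen fun a b => ∃ e ∈ T, G.IsLink e a b

/-- The edges in `T` form no cycle of `G`. -/
def Forest (G : Graph α β) (T : Set β) : Prop :=
  ∀ e ∈ T, ∀ x y, G.IsLink e x y → ¬ Conn G (T \ {e}) x y

namespace Conn

variable {G : Graph α β} {T S : Set β} {x y z : α}

lemma refl : Conn G T x x := Relation.ReflTransGen.refl

lemma symm (h : Conn G T x y) : Conn G T y x := by
  induction h with
  | refl => exact refl
  | tail _ h ih =>
    obtain ⟨e, he, h⟩ := h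
    exact Relation.ReflTransGen.head ⟨e, he, h.symm⟩ ih

lemma trans (h : Conn G T x y) (h' : Conn G T y z) : Conn G T x z :=
  Relation.ReflTransGen.trans h h'

lemma mono (hTS : T ⊆ S) (h : Conn G T x y) : Conn G S x y :=
  Relation.ReflTransGen.mono (fun _ _ ⟨e, he, h⟩ => ⟨e, hTS he, h⟩) _ _ h

lemma of_link {e : β} (he : e ∈ T) (h : G.IsLink e x y) : Conn G T x y :=
  Relation.ReflTransGen.single ⟨e, he, h⟩

lemma map (φ : α → α') (h : Conn G T x y) : Conn (G.map φ) T (φ x) (φ y) :=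
  Relation.ReflTransGen.lift φ (fun _ _ ⟨e, he, h⟩ => ⟨e, he, h.map φ⟩) _ _ h

lemma comm : Conn G T x y ↔ Conn G T y x := ⟨symm, symm⟩

end Conn

lemma reachable_restrict (G : Graph α β) (T : Set β) (x y : α) :
    Reachable (G.restrict T) x y ↔ Conn G T x y := by
  have : (G.restrict T).Adj = fun a b => ∃ e ∈ T, G.IsLink e a b := by
    ext a b
    simp [Graph.Adj]
  rw [Reachable, this, Conn]

lemma isSpanningTree_iff {G : Graph α β} {T : Set β} :
    IsSpanningTree G T ↔ T ⊆ G.edgeSet ∧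
      (G.vertexSet.Nonempty ∧ ∀ x ∈ G.vertexSet, ∀ y ∈ G.vertexSet, Conn G T x y) ∧
      Forest G T := by
  unfold IsSpanningTree IsConnected IsAcyclic Forest
  refine and_congr Iff.rfl (and_congr ?_ ?_)
  · simp only [reachable_restrict, Graph.vertexSet_restrict]
  · have key (e : β) (x y : α) :
        Reachable ((G.restrict T).deleteEdges {e}) x y ↔ Conn G (T \ {e}) x y := by
      rw [← reachable_restrict, Reachable, Reachable]
      have : ((G.restrict T).deleteEdges {e}).Adj = (G.restrict (T \ {e})).Adj := by
        ext a b
        simp only [Graph.Adj, Graph.deleteEdges_isLink, Graph.restrict_isLink, Set.mem_sdiff]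
        tauto
      rw [this]
    simp only [key, Graph.restrict_isLink]
    exact ⟨fun h e he x y hl => h e x y ⟨he, hl⟩, fun h e x y hl => h e hl.1 x y hl.2⟩

/-- The map `φ` identifies the vertices `p` and `q` and nothing else. -/
def Identifies (φ : α → α') (p q : α) : Prop :=
  ∀ x y, φ x = φ y ↔ x = y ∨ (x = p ∧ y = q) ∨ (x = q ∧ y = p)

/-- A walk in the quotient lifts to pieces of walks in `G` with jumps between `p` and `q`; all jumps
but at most one can be dropped. -/
lemma conn_map_iff {G : Graph α β} {T : Set β} {φ : α → α'} {p q : α} (hφ : Identifies φ p q)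
    (x y : α) : Conn (G.map φ) T (φ x) (φ y) ↔
      Conn G T x y ∨ (Conn G T x p ∧ Conn G T q y) ∨ (Conn G T x q ∧ Conn G T p y) := by
  have hpq : φ p = φ q := (hφ p q).2 (by simp)
  constructor
  · suffices H : ∀ b, Conn (G.map φ) T (φ x) b → ∀ y, b = φ y →
        Conn G T x y ∨ (Conn G T x p ∧ Conn G T q y) ∨ (Conn G T x q ∧ Conn G T p y) from
      fun h => H _ h y rfl
    intro b hb
    have base : ∀ z y, φ z = φ y →
        (Conn G T x z ∨ (Conn G T x p ∧ Conn G T q z) ∨ (Conn G T x q ∧ Conn G T p z)) →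
        (Conn G T x y ∨ (Conn G T x p ∧ Conn G T q y) ∨ (Conn G T x q ∧ Conn G T p y)) := by
      intro z y hzy h
      rcases (hφ z y).1 hzy with rfl | ⟨rfl, rfl⟩ | ⟨rfl, rfl⟩
      · exact h
      · rcases h with h | h | h
        · exact Or.inr (Or.inl ⟨h, Conn.refl⟩)
        · exact Or.inr (Or.inl ⟨h.1, Conn.refl⟩)
        · exact Or.inl h.1
      · rcases h with h | h | h
        · exact Or.inr (Or.inr ⟨h, Conn.refl⟩)
        · exact Or.inl h.1
        · exact Or.inr (Or.inr ⟨h.1, Conn.refl⟩)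
    induction hb with
    | refl => exact fun y hy => base x y hy (Or.inl Conn.refl)
    | tail _ h ih =>
      obtain ⟨e, he, c, d, hl, rfl, rfl⟩ := h
      intro y hy
      refine base d y hy ?_
      have hcd : Conn G T c d := Conn.of_link he hl
      rcases ih c rfl with h | h | h
      · exact Or.inl (h.trans hcd)
      · exact Or.inr (Or.inl ⟨h.1, h.2.trans hcd⟩)
      · exact Or.inr (Or.inr ⟨h.1, h.2.trans hcd⟩)
  · rintro (h | h | h)
    · exact h.map φ
    · exact (h.1.map φ).trans (hpq ▸ h.2.map φ)
    · exact (h.1.map φ).trans (hpq ▸ h.2.map φ)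

/-- Cut the walk at its first arrival at `q`: the part before stays away from `q`, so it cannot use
the arriving edge. -/
lemma Conn.exists_last {G : Graph α β} {T : Set β} {p q : α} (h : Conn G T p q) (hne : p ≠ q) :
    ∃ e ∈ T, ∃ x, G.IsLink e x q ∧ Conn G (T \ {e}) p x := by
  suffices H : ∃ e ∈ T, ∃ x, G.IsLink e x q ∧
      Relation.ReflTransGen (fun a b => (∃ e ∈ T, G.IsLink e a b) ∧ a ≠ q ∧ b ≠ q) p x by
    obtain ⟨e, he, x, hl, hx⟩ := H
    refine ⟨e, he, x, hl, Relation.ReflTransGen.mono ?_ _ _ hx⟩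
    rintro a b ⟨⟨f, hf, hab⟩, ha, hb⟩
    refine ⟨f, ⟨hf, ?_⟩, hab⟩
    rintro rfl
    rcases hl.right_eq_or_eq hab with h | h
    · exact ha h.symm
    · exact hb h.symm
  induction h using Relation.ReflTransGen.head_induction_on with
  | refl => exact absurd rfl hne
  | @head a b hab _ ih =>
    by_cases hb : b = q
    · subst hb
      obtain ⟨e, he, hl⟩ := hab
      exact ⟨e, he, a, hl, Relation.ReflTransGen.refl⟩
    · obtain ⟨e, he, x, hl, hx⟩ := ih hb
      exact ⟨e, he, x, hl, hx.head ⟨hab, hne, hb⟩⟩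

/-- Gluing `p` to `q` closes a cycle exactly when `T` already joins them; `Conn.exists_last`
supplies an edge on that cycle. -/
lemma forest_map_iff {G : Graph α β} {T : Set β} {φ : α → α'} {p q : α}
    (hφ : Identifies φ p q) (hpq : p ≠ q) :
    Forest (G.map φ) T ↔ Forest G T ∧ ¬ Conn G T p q := by
  constructor
  · refine fun h => ⟨fun e he x y hl hc => h e he _ _ (hl.map φ) (hc.map φ), fun hc => ?_⟩
    obtain ⟨e, he, x, hl, hx⟩ := hc.exists_last hpq
    exact h e he _ _ (hl.map φ) ((conn_map_iff hφ _ _).2 (Or.inr (Or.inl ⟨hx.symm, Conn.refl⟩)))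
  · rintro ⟨hf, hc⟩ e he _ _ ⟨x, y, hl, rfl, rfl⟩ h
    have hxy : Conn G T x y := Conn.of_link he hl
    have hs : T \ {e} ⊆ T := Set.sdiff_subset
    rcases (conn_map_iff hφ _ _).1 h with h | h | h
    · exact hf e he _ _ hl h
    · exact hc ((h.1.mono hs).symm.trans (hxy.trans (h.2.mono hs).symm))
    · exact hc ((h.2.mono hs).trans (hxy.symm.trans (h.1.mono hs)))

section DisjointUnion

variable {G : Graph α β} {H : Graph α' β'} {T : Set (β ⊕ β')}

lemma conn_disjointUnion_inl (x : α) (b : α ⊕ α') :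
    Conn (disjointUnion G H) T (Sum.inl x) b ↔
      ∃ y, b = Sum.inl y ∧ Conn G (Sum.inl ⁻¹' T) x y := by
  constructor
  · intro h
    induction h with
    | refl => exact ⟨x, rfl, Conn.refl⟩
    | tail _ h ih =>
      obtain ⟨y, rfl, hy⟩ := ih
      obtain ⟨e | e, he, c, d, hl, hc, rfl⟩ := h
      · cases hc
        exact ⟨d, rfl, hy.trans (Conn.of_link he hl)⟩
      · cases hc
  · rintro ⟨y, rfl, h⟩
    exact Relation.ReflTransGen.lift Sum.inl
      (fun a b ⟨e, he, h⟩ => ⟨Sum.inl e, he, a, b, h, rfl, rfl⟩) _ _ h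

lemma conn_disjointUnion_inr (x : α') (b : α ⊕ α') :
    Conn (disjointUnion G H) T (Sum.inr x) b ↔
      ∃ y, b = Sum.inr y ∧ Conn H (Sum.inr ⁻¹' T) x y := by
  constructor
  · intro h
    induction h with
    | refl => exact ⟨x, rfl, Conn.refl⟩
    | tail _ h ih =>
      obtain ⟨y, rfl, hy⟩ := ih
      obtain ⟨e | e, he, c, d, hl, hc, rfl⟩ := h
      · cases hc
      · cases hc
        exact ⟨d, rfl, hy.trans (Conn.of_link he hl)⟩
  · rintro ⟨y, rfl, h⟩
    exact Relation.ReflTransGen.lift Sum.inr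
      (fun a b ⟨e, he, h⟩ => ⟨Sum.inr e, he, a, b, h, rfl, rfl⟩) _ _ h

lemma forest_disjointUnion :
    Forest (disjointUnion G H) T ↔ Forest G (Sum.inl ⁻¹' T) ∧ Forest H (Sum.inr ⁻¹' T) := by
  have hl (e : β) : (Sum.inl ⁻¹' (T \ {Sum.inl e}) : Set β) = Sum.inl ⁻¹' T \ {e} := by
    ext; simp
  have hr (e : β') : (Sum.inr ⁻¹' (T \ {Sum.inr e}) : Set β') = Sum.inr ⁻¹' T \ {e} := by
    ext; simp
  constructor
  · intro h
    refine ⟨fun e he x y hxy hc => ?_, fun e he x y hxy hc => ?_⟩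
    · refine h (Sum.inl e) he _ _ ⟨x, y, hxy, rfl, rfl⟩ ?_
      rw [conn_disjointUnion_inl, hl]
      exact ⟨y, rfl, hc⟩
    · refine h (Sum.inr e) he _ _ ⟨x, y, hxy, rfl, rfl⟩ ?_
      rw [conn_disjointUnion_inr, hr]
      exact ⟨y, rfl, hc⟩
  · rintro ⟨h1, h2⟩ (e | e) he _ _ ⟨x, y, hxy, rfl, rfl⟩ hc
    · rw [conn_disjointUnion_inl, hl] at hc
      obtain ⟨_, h, hc⟩ := hc
      cases h
      exact h1 e he x y hxy hc
    · rw [conn_disjointUnion_inr, hr] at hc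
      obtain ⟨_, h, hc⟩ := hc
      cases h
      exact h2 e he x y hxy hc

end DisjointUnion

end Conn

/-! ### Spanning trees of graphs glued at one or two vertices -/

section Gluing

variable {α α' α₁ α₂ : Type u} {β β' : Type v}

/-- `T` is the edge set of a spanning forest of `G` with exactly two components, one of which
contains `p` and the other `q`. -/
def IsSep (G : Graph α β) (p q : α) (T : Set β) : Prop :=
  T ⊆ G.edgeSet ∧ (¬ Conn G T p q ∧ ∀ x ∈ G.vertexSet, Conn G T p x ∨ Conn G T q x) ∧ Forest G T

lemma isSpanningTree_iff_of_mem {G : Graph α β} {T : Set β} {p : α} (hp : p ∈ G.vertexSet) :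
    IsSpanningTree G T ↔ T ⊆ G.edgeSet ∧ (∀ x ∈ G.vertexSet, Conn G T p x) ∧ Forest G T := by
  rw [isSpanningTree_iff]
  refine and_congr Iff.rfl (and_congr ⟨fun h => h.2 p hp, fun h => ⟨⟨p, hp⟩, ?_⟩⟩ Iff.rfl)
  exact fun x hx y hy => (h x hx).symm.trans (h y hy)

lemma isSep_comm {G : Graph α β} {p q : α} {T : Set β} : IsSep G p q T ↔ IsSep G q p T := by
  unfold IsSep
  rw [Conn.comm (x := p)]
  simp only [or_comm]

/-- This describes `P_G` by forests of `G` itself, without a quotient graph. -/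
lemma isSpanningTree_map_iff {G : Graph α β} {T : Set β} {φ : α → α'} {p q : α}
    (hφ : Identifies φ p q) (hpq : p ≠ q) (hp : p ∈ G.vertexSet) :
    IsSpanningTree (G.map φ) T ↔ IsSep G p q T := by
  rw [isSpanningTree_iff_of_mem (show φ p ∈ (G.map φ).vertexSet from ⟨p, hp, rfl⟩), IsSep, forest_map_iff hφ hpq]
  simp only [Graph.edgeSet_map, Graph.vertexSet_map, Set.forall_mem_image, conn_map_iff hφ]
  have hc : (∀ x ∈ G.vertexSet, Conn G T p x ∨ (Conn G T p p ∧ Conn G T q x) ∨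
      (Conn G T p q ∧ Conn G T p x)) ↔ ∀ x ∈ G.vertexSet, Conn G T p x ∨ Conn G T q x := by
    refine forall₂_congr fun x _ => ?_
    have : Conn G T p p := Conn.refl
    tauto
  rw [hc]
  tauto

section Wedge

variable {G : Graph α β} {H : Graph α' β'} {T : Set (β ⊕ β')} {p : α} {q : α'}
  {f : α ⊕ α' → α₁}

lemma conn_wedge_inl_inl (hf : Identifies f (Sum.inl p) (Sum.inr q)) (x y : α) :
    Conn ((disjointUnion G H).map f) T (f (Sum.inl x)) (f (Sum.inl y)) ↔
      Conn G (Sum.inl ⁻¹' T) x y := by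
  simp [conn_map_iff hf, conn_disjointUnion_inl, conn_disjointUnion_inr]

lemma conn_wedge_inl_inr (hf : Identifies f (Sum.inl p) (Sum.inr q)) (x : α) (y : α') :
    Conn ((disjointUnion G H).map f) T (f (Sum.inl x)) (f (Sum.inr y)) ↔
      Conn G (Sum.inl ⁻¹' T) x p ∧ Conn H (Sum.inr ⁻¹' T) q y := by
  simp [conn_map_iff hf, conn_disjointUnion_inl, conn_disjointUnion_inr]

lemma conn_wedge_inr_inl (hf : Identifies f (Sum.inl p) (Sum.inr q)) (x : α') (y : α) :
    Conn ((disjointUnion G H).map f) T (f (Sum.inr x)) (f (Sum.inl y)) ↔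
      Conn H (Sum.inr ⁻¹' T) x q ∧ Conn G (Sum.inl ⁻¹' T) p y := by
  simp [conn_map_iff hf, conn_disjointUnion_inl, conn_disjointUnion_inr]

lemma conn_wedge_inr_inr (hf : Identifies f (Sum.inl p) (Sum.inr q)) (x y : α') :
    Conn ((disjointUnion G H).map f) T (f (Sum.inr x)) (f (Sum.inr y)) ↔
      Conn H (Sum.inr ⁻¹' T) x y := by
  simp [conn_map_iff hf, conn_disjointUnion_inl, conn_disjointUnion_inr]

lemma forest_wedge (hf : Identifies f (Sum.inl p) (Sum.inr q)) :
    Forest ((disjointUnion G H).map f) T ↔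
      Forest G (Sum.inl ⁻¹' T) ∧ Forest H (Sum.inr ⁻¹' T) := by
  simp [forest_map_iff hf, conn_disjointUnion_inl, forest_disjointUnion]

lemma subset_edgeSet_disjointUnion : T ⊆ (disjointUnion G H).edgeSet ↔
    Sum.inl ⁻¹' T ⊆ G.edgeSet ∧ Sum.inr ⁻¹' T ⊆ H.edgeSet := by
  simp [Set.subset_def, disjointUnion]

lemma forall_mem_vertexSet_disjointUnion {P : α ⊕ α' → Prop} :
    (∀ x ∈ (disjointUnion G H).vertexSet, P x) ↔
      (∀ x ∈ G.vertexSet, P (Sum.inl x)) ∧ ∀ x ∈ H.vertexSet, P (Sum.inr x) := by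
  simp [disjointUnion]

lemma isSpanningTree_wedge (hf : Identifies f (Sum.inl p) (Sum.inr q)) (hp : p ∈ G.vertexSet)
    (hq : q ∈ H.vertexSet) :
    IsSpanningTree ((disjointUnion G H).map f) T ↔
      IsSpanningTree G (Sum.inl ⁻¹' T) ∧ IsSpanningTree H (Sum.inr ⁻¹' T) := by
  rw [isSpanningTree_iff_of_mem hp, isSpanningTree_iff_of_mem hq,
    isSpanningTree_iff_of_mem (show f (Sum.inl p) ∈ ((disjointUnion G H).map f).vertexSet from
      ⟨_, Or.inl ⟨p, hp, rfl⟩, rfl⟩), forest_wedge hf]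
  simp only [Graph.edgeSet_map, Graph.vertexSet_map, Set.forall_mem_image,
    forall_mem_vertexSet_disjointUnion, conn_wedge_inl_inl hf, conn_wedge_inl_inr hf,
    subset_edgeSet_disjointUnion]
  have : Conn G (Sum.inl ⁻¹' T) p p := Conn.refl
  simp only [this, true_and]
  tauto

variable {p' : α} {q' : α'} {g : α₁ → α₂}

/-- The spanning trees of two graphs glued at two vertices. -/
lemma isSpanningTree_ring (hf : Identifies f (Sum.inl p) (Sum.inr q))
    (hg : Identifies g (f (Sum.inl p')) (f (Sum.inr q'))) (hpp : p ≠ p')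
    (hp : p ∈ G.vertexSet) (hp' : p' ∈ G.vertexSet) (hq : q ∈ H.vertexSet)
    (hq' : q' ∈ H.vertexSet) :
    IsSpanningTree (((disjointUnion G H).map f).map g) T ↔
      (IsSpanningTree G (Sum.inl ⁻¹' T) ∧ IsSep H q q' (Sum.inr ⁻¹' T)) ∨
      (IsSep G p p' (Sum.inl ⁻¹' T) ∧ IsSpanningTree H (Sum.inr ⁻¹' T)) := by
  have hne : f (Sum.inl p') ≠ f (Sum.inr q') := by
    rw [Ne, hf]
    simp [hpp.symm]
  rw [isSpanningTree_map_iff hg hne (show f (Sum.inl p') ∈ ((disjointUnion G H).map f).vertexSet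
      from ⟨_, Or.inl ⟨p', hp', rfl⟩, rfl⟩),
    isSpanningTree_iff_of_mem hp, isSpanningTree_iff_of_mem hq, IsSep, IsSep, IsSep,
    forest_wedge hf]
  simp only [Graph.edgeSet_map, Graph.vertexSet_map, Set.forall_mem_image,
    forall_mem_vertexSet_disjointUnion, conn_wedge_inl_inl hf, conn_wedge_inl_inr hf,
    conn_wedge_inr_inl hf, conn_wedge_inr_inr hf, subset_edgeSet_disjointUnion]
  set T₁ := Sum.inl ⁻¹' T
  set T₂ := Sum.inr ⁻¹' T
  constructor
  · rintro ⟨⟨hE, hE'⟩, ⟨hn, h1, h2⟩, hF, hF'⟩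
    -- Exactly one side joins its two gluing vertices: if both did, a cycle would close; if neither
    -- did, `p` would be cut off from both copies of the second gluing vertex.
    by_cases hc : Conn G T₁ p p'
    · have hd : ¬ Conn H T₂ q q' := fun h => hn ⟨hc.symm, h⟩
      refine Or.inl ⟨⟨hE, fun x hx => ?_, hF⟩, hE', ⟨hd, fun x hx => ?_⟩, hF'⟩
      · rcases h1 x hx with h | h
        · exact hc.trans h
        · exact absurd h.1.symm hd
      · rcases h2 x hx with h | h
        · exact Or.inl h.2
        · exact Or.inr h
    · refine Or.inr ⟨⟨hE, ⟨hc, fun x hx => ?_⟩, hF⟩, hE', fun x hx => ?_, hF'⟩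
      · rcases h1 x hx with h | h
        · exact Or.inr h
        · exact Or.inl h.2
      · have hd : Conn H T₂ q q' := by
          rcases h1 p hp with h | h
          · exact absurd h.symm hc
          · exact h.1.symm
        rcases h2 x hx with h | h
        · exact h.2
        · exact hd.trans h
  · rintro (⟨⟨hE, h1, hF⟩, hE', ⟨hn, h2⟩, hF'⟩ | ⟨⟨hE, ⟨hn, h1⟩, hF⟩, hE', h2, hF'⟩)
    · refine ⟨⟨hE, hE'⟩, ⟨fun h => hn h.2, fun x hx => ?_, fun x hx => ?_⟩, hF, hF'⟩
      · exact Or.inl ((h1 p' hp').symm.trans (h1 x hx))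
      · exact (h2 x hx).imp (fun h => ⟨(h1 p' hp').symm, h⟩) id
    · refine ⟨⟨hE, hE'⟩, ⟨fun h => hn h.1.symm, fun x hx => ?_, fun x hx => ?_⟩, hF, hF'⟩
      · exact (h1 x hx).symm.imp id fun h => ⟨(h2 q' hq').symm, h⟩
      · exact Or.inr ((h2 q' hq').symm.trans (h2 x hx))

/-- A path between the gluing vertices on either side would join the two components, so both sides
must separate them. -/
lemma isSep_ring (hf : Identifies f (Sum.inl p) (Sum.inr q))
    (hg : Identifies g (f (Sum.inl p')) (f (Sum.inr q'))) (hpp : p ≠ p') :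
    IsSep (((disjointUnion G H).map f).map g) (g (f (Sum.inl p))) (g (f (Sum.inl p'))) T ↔
      IsSep G p p' (Sum.inl ⁻¹' T) ∧ IsSep H q q' (Sum.inr ⁻¹' T) := by
  have hne : f (Sum.inl p') ≠ f (Sum.inr q') := by
    rw [Ne, hf]
    simp [hpp.symm]
  rw [IsSep, IsSep, IsSep, forest_map_iff hg hne, forest_wedge hf]
  simp only [Graph.edgeSet_map, Graph.vertexSet_map, Set.forall_mem_image, conn_map_iff hg,
    forall_mem_vertexSet_disjointUnion, conn_wedge_inl_inl hf, conn_wedge_inl_inr hf,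
    conn_wedge_inr_inl hf, conn_wedge_inr_inr hf, subset_edgeSet_disjointUnion]
  set T₁ := Sum.inl ⁻¹' T
  set T₂ := Sum.inr ⁻¹' T
  have r1 : Conn G T₁ p p := Conn.refl
  have r2 : Conn G T₁ p' p' := Conn.refl
  have e1 : Conn G T₁ p' p ↔ Conn G T₁ p p' := Conn.comm
  have e2 : Conn H T₂ q' q ↔ Conn H T₂ q q' := Conn.comm
  simp only [r1, r2, e1, e2, true_and, and_true]
  constructor
  · rintro ⟨⟨hE, hE'⟩, ⟨hn, h1, h2⟩, ⟨hF, hF'⟩, -⟩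
    have n1 : ¬ Conn G T₁ p p' := fun h => hn (Or.inl h)
    have n2 : ¬ Conn H T₂ q q' := fun h => hn (Or.inr (Or.inr h))
    simp only [n1, n2, false_and, or_false, false_or] at h1 h2
    exact ⟨⟨hE, ⟨n1, fun x hx => h1 x hx⟩, hF⟩, hE', ⟨n2, fun x hx => h2 x hx⟩, hF'⟩
  · rintro ⟨⟨hE, ⟨n1, h1⟩, hF⟩, hE', ⟨n2, h2⟩, hF'⟩
    simp only [n1, n2, false_and, or_false, false_or, not_false_eq_true, and_true, true_and]
    exact ⟨⟨hE, hE'⟩, ⟨fun x hx => h1 x hx, fun x hx => h2 x hx⟩, hF, hF'⟩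

end Wedge

end Gluing

/-! ### Spanning trees of joins and of `K₂` -/

namespace STGraph

variable {α α' : Type u} {β β' : Type v} (G : STGraph α β) (H : STGraph α' β')

/-- The edge sets of the spanning trees of `G`. -/
def Tree (T : Set β) : Prop := IsSpanningTree G.toGraph T

/-- The edge sets of the spanning trees of `G` with source and terminal identified. -/
def Sep (T : Set β) : Prop := IsSep G.toGraph G.source G.terminal T

open Classical in
lemma isSpanningTree_breaker_iff (T : Set β) :
    IsSpanningTree (G.toGraph.map fun v => if v = G.terminal then G.source else v) T ↔
      G.Sep T := by
  refine isSpanningTree_map_iff (fun x y => ?_) G.source_ne_terminal G.source_mem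
  have := G.source_ne_terminal
  split_ifs with h1 h2 h2 <;> grind

-- The join is split into two successive identifications of a single pair, the form required by the
-- gluing lemmas.
open Classical in
lemma parallelJoin_toGraph : (G.parallelJoin H).toGraph =
    ((disjointUnion G.toGraph H.toGraph).map
      fun v => if v = Sum.inr H.source then Sum.inl G.source else v).map
      fun v => if v = Sum.inr H.terminal then Sum.inl G.terminal else v := by
  rw [Graph.map_map]
  have := H.source_ne_terminal
  change Graph.map _ _ = _
  congr 1
  funext v
  simp only [Function.comp]
  split_ifs <;> simp_all

open Classical in
lemma identifies_source : Identifies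
    (fun v => if v = Sum.inr H.source then Sum.inl G.source else v : α ⊕ α' → α ⊕ α')
    (Sum.inl G.source) (Sum.inr H.source) := by
  intro x y
  dsimp only
  split_ifs <;> grind

open Classical in
lemma identifies_terminal : Identifies
    (fun v => if v = Sum.inr H.terminal then Sum.inl G.terminal else v : α ⊕ α' → α ⊕ α')
    (Sum.inl G.terminal) (Sum.inr H.terminal) := by
  intro x y
  dsimp only
  split_ifs <;> grind

open Classical in
lemma identifies_middle : Identifies
    (fun v => if v = Sum.inr H.source then Sum.inl G.terminal else v : α ⊕ α' → α ⊕ α')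
    (Sum.inl G.terminal) (Sum.inr H.source) := by
  intro x y
  dsimp only
  split_ifs <;> grind

variable {G H}

lemma tree_parallelJoin {T : Set (β ⊕ β')} : (G.parallelJoin H).Tree T ↔
    (G.Tree (Sum.inl ⁻¹' T) ∧ H.Sep (Sum.inr ⁻¹' T)) ∨
    (G.Sep (Sum.inl ⁻¹' T) ∧ H.Tree (Sum.inr ⁻¹' T)) := by
  classical
  rw [Tree, parallelJoin_toGraph]
  refine isSpanningTree_ring (identifies_source G H) ?_ G.source_ne_terminal G.source_mem
    G.terminal_mem H.source_mem H.terminal_mem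
  simpa [H.source_ne_terminal.symm] using identifies_terminal G H

lemma sep_parallelJoin {T : Set (β ⊕ β')} : (G.parallelJoin H).Sep T ↔
    G.Sep (Sum.inl ⁻¹' T) ∧ H.Sep (Sum.inr ⁻¹' T) := by
  classical
  have := isSep_ring (G := G.toGraph) (H := H.toGraph) (T := T) (identifies_source G H)
    (p' := G.terminal) (q' := H.terminal)
    (g := fun v => if v = Sum.inr H.terminal then Sum.inl G.terminal else v)
    (by simpa [H.source_ne_terminal.symm] using identifies_terminal G H) G.source_ne_terminal
  rw [← parallelJoin_toGraph] at this
  simp only [reduceCtorEq, if_false] at this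
  exact this

lemma tree_seriesJoin {T : Set (β ⊕ β')} : (G.seriesJoin H).Tree T ↔
    G.Tree (Sum.inl ⁻¹' T) ∧ H.Tree (Sum.inr ⁻¹' T) := by
  classical
  exact isSpanningTree_wedge (identifies_middle G H) G.terminal_mem H.source_mem

lemma sep_seriesJoin {T : Set (β ⊕ β')} : (G.seriesJoin H).Sep T ↔
    (G.Tree (Sum.inl ⁻¹' T) ∧ H.Sep (Sum.inr ⁻¹' T)) ∨
    (G.Sep (Sum.inl ⁻¹' T) ∧ H.Tree (Sum.inr ⁻¹' T)) := by
  classical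
  -- Identifying the ends of a series join closes it to a ring. The first gluing takes place at the
  -- terminal of `G`, hence the swap of source and terminal for `G`.
  rw [← isSpanningTree_breaker_iff, show G.Sep _ ↔ _ from isSep_comm]
  refine isSpanningTree_ring (identifies_middle G H) (fun x y => ?_) G.source_ne_terminal.symm
    G.terminal_mem G.source_mem H.source_mem H.terminal_mem
  have h1 : (G.seriesJoin H).source = Sum.inl G.source := rfl
  have h2 : (G.seriesJoin H).terminal = Sum.inr H.terminal := rfl
  have h3 := H.source_ne_terminal
  simp only [h1, h2, if_neg (show ¬ (Sum.inl G.source : α ⊕ α') = Sum.inr H.source by simp),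
    if_neg (show ¬ (Sum.inr H.terminal : α ⊕ α') = Sum.inr H.source by simpa using h3.symm)]
  split_ifs <;> grind

lemma tree_of_isK2 {e : β} (hV : G.vertexSet = {G.source, G.terminal}) (hE : G.edgeSet = {e})
    (hl : G.IsLink e G.source G.terminal) {T : Set β} : G.Tree T ↔ T = {e} := by
  have empty {x y : α} (h : Conn G.toGraph ∅ x y) : x = y := by
    induction h with
    | refl => rfl
    | tail _ h _ => exact absurd h.choose_spec.1 (by simp)
  rw [Tree, isSpanningTree_iff_of_mem G.source_mem, hV, hE]
  constructor
  · rintro ⟨h1, h2, -⟩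
    rcases Set.subset_singleton_iff_eq.1 h1 with rfl | rfl
    · exact absurd (empty (h2 G.terminal (by simp))) G.source_ne_terminal
    · rfl
  · rintro rfl
    refine ⟨subset_rfl, ?_, ?_⟩
    · rintro x (rfl | rfl)
      · exact Conn.refl
      · exact Conn.of_link rfl hl
    · rintro _ rfl x y hxy hc
      rw [sdiff_self] at hc
      have := empty hc
      subst this
      have hs : G.source = x := by simpa using hl.left_eq_or_eq hxy
      have ht : G.terminal = x := by simpa using hl.right_eq_or_eq hxy
      exact G.source_ne_terminal (hs.trans ht.symm)

lemma sep_of_isK2 {e : β} (hV : G.vertexSet = {G.source, G.terminal}) (hE : G.edgeSet = {e})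
    (hl : G.IsLink e G.source G.terminal) {T : Set β} : G.Sep T ↔ T = ∅ := by
  have empty {x y : α} (h : Conn G.toGraph ∅ x y) : x = y := by
    induction h with
    | refl => rfl
    | tail _ h _ => exact absurd h.choose_spec.1 (by simp)
  rw [Sep, IsSep, hV, hE]
  constructor
  · rintro ⟨h1, ⟨h2, -⟩, -⟩
    rcases Set.subset_singleton_iff_eq.1 h1 with rfl | rfl
    · rfl
    · exact absurd (Conn.of_link (Set.mem_singleton e) hl) h2
  · rintro rfl
    refine ⟨Set.empty_subset _, ⟨fun h => G.source_ne_terminal (empty h), ?_⟩, ?_⟩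
    · rintro x (rfl | rfl)
      · exact Or.inl Conn.refl
      · exact Or.inr Conn.refl
    · rintro _ ⟨⟩

end STGraph

/-! ### Tree polynomials: products, degrees, derivatives -/

section TreePoly

variable {β β' : Type v}

lemma pderiv_prod_eq_zero (e : β) (s : Finset β) (g : β → MvPolynomial β ℚ)
    (h : ∀ f ∈ s, pderiv e (g f) = 0) : pderiv e (∏ f ∈ s, g f) = 0 :=
  Finset.prod_induction _ (fun p => pderiv e p = 0)
    (fun a b ha hb => by rw [pderiv_mul, ha, hb]; simp) pderiv_one h

lemma isSpanningTree_deleteEdges {α : Type u} {G : Graph α β} {e : β} {T : Set β} :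
    IsSpanningTree (G.deleteEdges {e}) T ↔ e ∉ T ∧ IsSpanningTree G T := by
  have hc {S : Set β} (hS : e ∉ S) : Conn (G.deleteEdges {e}) S = Conn G S := by
    unfold Conn
    congr 1
    ext a b
    simp only [Graph.deleteEdges_isLink]
    exact exists_congr fun f => and_congr_right fun hf =>
      and_iff_left (fun h => hS (h ▸ hf))
  by_cases heT : e ∈ T
  · simp only [heT, not_true_eq_false, false_and, iff_false]
    intro h
    have := h.1 heT
    simp at this
  · rw [isSpanningTree_iff, isSpanningTree_iff]
    have h1 : T ⊆ (G.deleteEdges {e}).edgeSet ↔ T ⊆ G.edgeSet := by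
      simp [Set.subset_sdiff, heT]
    have h2 : Forest (G.deleteEdges {e}) T ↔ Forest G T := by
      unfold Forest
      refine forall₂_congr fun f hf => forall₂_congr fun x y => ?_
      rw [hc (fun h => heT h.1), Graph.deleteEdges_isLink]
      have : f ∉ ({e} : Set β) := fun h => heT (h ▸ hf)
      tauto
    simp only [h1, h2, hc heT, Graph.vertexSet_deleteEdges, heT, not_false_eq_true, true_and]

variable [Fintype β] [Fintype β']

open Classical in
/-- The sum over the sets `T` with the property `P` of the products of the variables in
`E \ T`. -/
noncomputable def treePoly (E : Set β) (P : Set β → Prop) : MvPolynomial β ℚ :=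
  ∑ T : Finset β, if P T then ∏ e, if e ∈ E ∧ e ∉ T then X e else 1 else 0

-- The sum in `kirchhoff` runs over finsets coerced to sets by a monadic lift; this makes the index
-- set an ordinary image.
open Classical in
lemma bind_pure_coe : ((Finset.univ : Finset (Finset β)) >>= fun a => pure (a : Set β)) =
    Finset.univ.image fun a : Finset β => (a : Set β) := by
  change Finset.sup _ _ = _
  ext T
  simp [eq_comm]

lemma kirchhoff_eq_treePoly {α : Type u} (G : Graph α β) :
    kirchhoff G = treePoly G.edgeSet (IsSpanningTree G) := by
  classical
  rw [kirchhoff, treePoly, Finset.sum_filter]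
  refine (Finset.sum_congr bind_pure_coe fun _ _ => rfl).trans ?_
  rw [Finset.sum_image fun _ _ _ _ h => Finset.coe_injective h]
  simp only [Finset.prod_filter, Finset.mem_coe]

lemma treePoly_or (E : Set β) {P Q : Set β → Prop} (h : ∀ T, P T → ¬ Q T) :
    treePoly E (fun T => P T ∨ Q T) = treePoly E P + treePoly E Q := by
  rw [treePoly, treePoly, treePoly, ← Finset.sum_add_distrib]
  refine Finset.sum_congr rfl fun T _ => ?_
  have := h T
  by_cases h1 : P T <;> by_cases h2 : Q T <;> simp_all

lemma treePoly_sum (E : Set β) (E' : Set β') (P : Set β → Prop) (Q : Set β' → Prop) :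
    treePoly (Sum.inl '' E ∪ Sum.inr '' E') (fun T => P (Sum.inl ⁻¹' T) ∧ Q (Sum.inr ⁻¹' T)) =
      rename Sum.inl (treePoly E P) * rename Sum.inr (treePoly E' Q) := by
  classical
  rw [treePoly, treePoly, treePoly, map_sum, map_sum, Finset.sum_mul_sum,
    ← Finset.sum_product', Finset.univ_product_univ,
    ← Equiv.sum_comp (Finset.sumEquiv (α := β) (β := β')).symm.toEquiv]
  refine Finset.sum_congr rfl fun T _ => ?_
  have h1 : (Sum.inl ⁻¹' ((Finset.disjSum T.1 T.2 : Finset (β ⊕ β')) : Set (β ⊕ β')) : Set β) =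
      T.1 := by ext; simp
  have h2 : (Sum.inr ⁻¹' ((Finset.disjSum T.1 T.2 : Finset (β ⊕ β')) : Set (β ⊕ β')) : Set β') =
      T.2 := by ext; simp
  have hS : (Finset.sumEquiv (α := β) (β := β')).symm.toEquiv T = T.1.disjSum T.2 := rfl
  simp only [hS, h1, h2]
  by_cases hP : P T.1
  · by_cases hQ : Q T.2
    · rw [if_pos ⟨hP, hQ⟩, if_pos hP, if_pos hQ, Fintype.prod_sum_type, map_prod, map_prod]
      congr 1 <;> refine Finset.prod_congr rfl fun e _ => ?_ <;> simp [apply_ite] <;> split_ifs <;> tauto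
    · simp [hQ]
  · simp [hP]

lemma isHomogeneous_treePoly {E : Set β} {P : Set β → Prop} {n : ℕ}
    (h : ∀ T, P T → (E \ T).ncard = n) : (treePoly E P).IsHomogeneous n := by
  classical
  refine IsHomogeneous.sum _ _ _ fun T _ => ?_
  split_ifs with hT
  · rw [← Finset.prod_filter]
    have hn : ∑ e ∈ Finset.univ.filter (fun e => e ∈ E ∧ e ∉ T), 1 = n := by
      rw [← h T hT, Finset.sum_const, smul_eq_mul, mul_one, ← Set.ncard_coe_finset]
      congr 1
      ext
      simp
    exact hn ▸ IsHomogeneous.prod _ _ _ fun e _ => isHomogeneous_X ℚ e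
  · exact isHomogeneous_zero _ _ _

/-- No cancellation occurs: the value with all variables equal to 1 counts the sets with property
`P`. -/
lemma treePoly_ne_zero {E : Set β} {P : Set β → Prop} (h : ∃ T, P T) : treePoly E P ≠ 0 := by
  classical
  obtain ⟨T, hT⟩ := h
  intro h0
  have h1 : eval (fun _ => (1 : ℚ)) (treePoly E P) = 0 := by rw [h0, map_zero]
  have h2 : eval (fun _ => (1 : ℚ)) (treePoly E P) = ∑ T : Finset β, if P T then 1 else 0 := by
    rw [treePoly, map_sum]
    refine Finset.sum_congr rfl fun T _ => ?_
    split_ifs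
    · rw [map_prod]
      exact Finset.prod_eq_one fun e _ => by split_ifs <;> simp
    · exact map_zero _
  rw [h2, Finset.sum_eq_zero_iff_of_nonneg (fun _ _ => by split_ifs <;> norm_num)] at h1
  have := h1 T.toFinite.toFinset (Finset.mem_univ _)
  simp [hT] at this

/-- Each monomial has degree at most one in `X e`, and `∂_e` keeps exactly those of the trees
avoiding `e`, which are the trees of the graph with `e` deleted. For a bridge both sides vanish. -/
lemma kirchhoff_deleteEdges {α : Type u} (G : Graph α β) {e : β} (he : e ∈ G.edgeSet) :
    kirchhoff (G.deleteEdges {e}) = pderiv e (kirchhoff G) := by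
  classical
  rw [kirchhoff_eq_treePoly, kirchhoff_eq_treePoly, treePoly, treePoly, map_sum]
  refine Finset.sum_congr rfl fun T _ => ?_
  simp only [isSpanningTree_deleteEdges, Finset.mem_coe]
  by_cases hT : IsSpanningTree G T
  · by_cases heT : e ∈ T
    · rw [if_neg (fun h => h.1 heT), if_pos hT, pderiv_prod_eq_zero]
      intro f _
      split_ifs with hf
      · exact pderiv_X_of_ne (fun h => hf.2 (h ▸ heT))
      · exact pderiv_one
    · set R : MvPolynomial β ℚ :=
        ∏ f ∈ Finset.univ.erase e, if f ∈ G.edgeSet ∧ f ∉ T then X f else 1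
      have h1 : (∏ f, if f ∈ (G.deleteEdges {e}).edgeSet ∧ f ∉ T then X f else 1) = R := by
        rw [← Finset.mul_prod_erase _ _ (Finset.mem_univ e), if_neg (by simp), one_mul]
        refine Finset.prod_congr rfl fun f hf => ?_
        have : f ≠ e := Finset.ne_of_mem_erase hf
        simp [this]
      have h2 : (∏ f, if f ∈ G.edgeSet ∧ f ∉ T then X f else 1) = X e * R := by
        rw [← Finset.mul_prod_erase _ _ (Finset.mem_univ e), if_pos ⟨he, heT⟩]
      have h3 : pderiv e R = 0 := by
        refine pderiv_prod_eq_zero e _ _ fun f hf => ?_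
        split_ifs
        · exact pderiv_X_of_ne (Finset.ne_of_mem_erase hf)
        · exact pderiv_one
      rw [if_pos ⟨heT, hT⟩, if_pos hT, h1, h2, pderiv_mul, h3, pderiv_X_self]
      simp
  · simp [hT]

end TreePoly

/-! ### Invariance under isomorphism -/

section Isomorphism

variable {α α' : Type u} {β β' : Type v} {G : Graph α β} {H : Graph α' β'} {f : α → α'}
  {g : β → β'}

/-- Isomorphism of multigraphs. -/
structure IsIso (G : Graph α β) (H : Graph α' β') (f : α → α') (g : β → β') : Prop where
  bijOn_vertexSet : Set.BijOn f G.vertexSet H.vertexSet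
  bijOn_edgeSet : Set.BijOn g G.edgeSet H.edgeSet
  isLink : ∀ e x y, G.IsLink e x y → H.IsLink (g e) (f x) (f y)

namespace IsIso

/-- Links are only assumed to be carried forward; a walk lifts back because an edge determines its
ends up to order and `f` is injective on vertices. -/
lemma conn_iff (h : IsIso G H f g) {T : Set β} (hT : T ⊆ G.edgeSet) {x y : α}
    (hx : x ∈ G.vertexSet) (hy : y ∈ G.vertexSet) :
    Conn H (g '' T) (f x) (f y) ↔ Conn G T x y := by
  constructor
  · intro hc
    suffices H : ∀ b, Conn H (g '' T) (f x) b → ∃ z ∈ G.vertexSet, f z = b ∧ Conn G T x z by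
      obtain ⟨z, hz, hzy, hxz⟩ := H _ hc
      rwa [h.bijOn_vertexSet.injOn hz hy hzy] at hxz
    intro b hb
    induction hb with
    | refl => exact ⟨x, hx, rfl, Conn.refl⟩
    | tail _ hl ih =>
      obtain ⟨z, hz, rfl, hxz⟩ := ih
      obtain ⟨_, ⟨e, he, rfl⟩, hl⟩ := hl
      obtain ⟨a, b, hab⟩ := Graph.exists_isLink_of_mem_edgeSet (hT he)
      have hab' := h.isLink e a b hab
      rcases hl.eq_and_eq_or_eq_and_eq hab' with ⟨h1, h2⟩ | ⟨h1, h2⟩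
      · have := h.bijOn_vertexSet.injOn hz hab.left_mem h1
        subst this
        exact ⟨b, hab.right_mem, h2.symm, hxz.trans (Conn.of_link he hab)⟩
      · have := h.bijOn_vertexSet.injOn hz hab.right_mem h1
        subst this
        exact ⟨a, hab.left_mem, h2.symm, hxz.trans (Conn.of_link he hab.symm)⟩
  · exact fun hc => Relation.ReflTransGen.lift f
      (fun a b ⟨e, he, hl⟩ => ⟨g e, ⟨e, he, rfl⟩, h.isLink e a b hl⟩) _ _ hc

lemma forest_iff (h : IsIso G H f g) {T : Set β} (hT : T ⊆ G.edgeSet) :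
    Forest H (g '' T) ↔ Forest G T := by
  have hd {e : β} (he : e ∈ T) : g '' T \ {g e} = g '' (T \ {e}) := by
    rw [(h.bijOn_edgeSet.injOn.mono hT).image_sdiff_subset (by simpa using he),
      Set.image_singleton]
  have hs (e : β) : T \ {e} ⊆ G.edgeSet := Set.sdiff_subset.trans hT
  constructor
  · intro hF e he x y hl hc
    refine hF (g e) ⟨e, he, rfl⟩ _ _ (h.isLink e x y hl) ?_
    rwa [hd he, h.conn_iff (hs e) hl.left_mem hl.right_mem]
  · rintro hF _ ⟨e, he, rfl⟩ a b hab hc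
    obtain ⟨x, y, hl⟩ := Graph.exists_isLink_of_mem_edgeSet (hT he)
    have hl' := h.isLink e x y hl
    rw [hd he] at hc
    rcases hab.eq_and_eq_or_eq_and_eq hl' with ⟨rfl, rfl⟩ | ⟨rfl, rfl⟩
    · exact hF e he x y hl ((h.conn_iff (hs e) hl.left_mem hl.right_mem).1 hc)
    · exact hF e he x y hl ((h.conn_iff (hs e) hl.left_mem hl.right_mem).1 hc.symm)

lemma subset_edgeSet (h : IsIso G H f g) {T : Set β} (hT : T ⊆ G.edgeSet) :
    g '' T ⊆ H.edgeSet := (Set.image_mono hT).trans h.bijOn_edgeSet.image_eq.subset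

lemma forall_vertexSet (h : IsIso G H f g) {P : α' → Prop} :
    (∀ x ∈ H.vertexSet, P x) ↔ ∀ x ∈ G.vertexSet, P (f x) := by
  rw [← h.bijOn_vertexSet.image_eq, Set.forall_mem_image]

lemma isSpanningTree_iff (h : IsIso G H f g) {T : Set β} (hT : T ⊆ G.edgeSet) {p : α}
    (hp : p ∈ G.vertexSet) : IsSpanningTree H (g '' T) ↔ IsSpanningTree G T := by
  rw [isSpanningTree_iff_of_mem hp, isSpanningTree_iff_of_mem (h.bijOn_vertexSet.mapsTo hp),
    h.forest_iff hT, h.forall_vertexSet]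
  simp only [hT, h.subset_edgeSet hT, true_and]
  exact and_congr_left fun _ => forall₂_congr fun x hx => h.conn_iff hT hp hx

lemma isSep_iff (h : IsIso G H f g) {T : Set β} (hT : T ⊆ G.edgeSet) {p q : α}
    (hp : p ∈ G.vertexSet) (hq : q ∈ G.vertexSet) :
    IsSep H (f p) (f q) (g '' T) ↔ IsSep G p q T := by
  rw [IsSep, IsSep, h.forest_iff hT, h.forall_vertexSet, h.conn_iff hT hp hq]
  simp only [hT, h.subset_edgeSet hT, true_and]
  exact and_congr_left fun _ => and_congr_right fun _ => forall₂_congr fun x hx =>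
    or_congr (h.conn_iff hT hp hx) (h.conn_iff hT hq hx)

lemma ncard_sdiff (h : IsIso G H f g) {T : Set β} (hT : T ⊆ G.edgeSet) :
    (H.edgeSet \ g '' T).ncard = (G.edgeSet \ T).ncard := by
  rw [← h.bijOn_edgeSet.image_eq, ← h.bijOn_edgeSet.injOn.image_sdiff_subset hT,
    (h.bijOn_edgeSet.injOn.mono Set.sdiff_subset).ncard_image]

end IsIso

end Isomorphism

/-! ### Degrees of the polynomials of series-parallel graphs -/

namespace STGraph

/-- The complements of the spanning trees of `G` have the same size, and those of the spanning
trees of `G` with source and terminal identified have one more element. -/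
def IsBalanced {α : Type u} {β : Type v} (G : STGraph α β) (n : ℕ) : Prop :=
  G.edgeSet.Finite ∧ (∃ T, G.Tree T) ∧ (∃ T, G.Sep T) ∧
    (∀ T, G.Tree T → (G.edgeSet \ T).ncard = n) ∧ ∀ T, G.Sep T → (G.edgeSet \ T).ncard = n + 1

variable {α α' : Type u} {β β' : Type v} {G : STGraph α β} {H : STGraph α' β'}

lemma ncard_sdiff_sum {E : Set β} {E' : Set β'} (hE : E.Finite) (hE' : E'.Finite)
    (T : Set (β ⊕ β')) : ((Sum.inl '' E ∪ Sum.inr '' E') \ T).ncard =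
      (E \ Sum.inl ⁻¹' T).ncard + (E' \ Sum.inr ⁻¹' T).ncard := by
  have : (Sum.inl '' E ∪ Sum.inr '' E') \ T =
      Sum.inl '' (E \ Sum.inl ⁻¹' T) ∪ Sum.inr '' (E' \ Sum.inr ⁻¹' T) := by
    ext (x | x) <;> simp
  rw [this, Set.ncard_union_eq ?_ (hE.sdiff.image _) (hE'.sdiff.image _),
    Set.ncard_image_of_injective _ Sum.inl_injective,
    Set.ncard_image_of_injective _ Sum.inr_injective]
  rw [Set.disjoint_left]
  rintro _ ⟨x, -, rfl⟩ ⟨y, -, h⟩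
  cases h

lemma exists_preimage (T₁ : Set β) (T₂ : Set β') :
    ∃ T : Set (β ⊕ β'), Sum.inl ⁻¹' T = T₁ ∧ Sum.inr ⁻¹' T = T₂ :=
  ⟨Sum.inl '' T₁ ∪ Sum.inr '' T₂, by ext; simp, by ext; simp⟩

lemma IsBalanced.parallelJoin {m n : ℕ} (hG : G.IsBalanced m) (hH : H.IsBalanced n) :
    (G.parallelJoin H).IsBalanced (m + n + 1) := by
  obtain ⟨hE, ⟨T₁, hT₁⟩, ⟨S₁, hS₁⟩, ht, hs⟩ := hG
  obtain ⟨hE', ⟨T₂, hT₂⟩, ⟨S₂, hS₂⟩, ht', hs'⟩ := hH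
  have he : (G.parallelJoin H).edgeSet = Sum.inl '' G.edgeSet ∪ Sum.inr '' H.edgeSet := rfl
  refine ⟨he ▸ (hE.image _).union (hE'.image _), ?_, ?_, fun T hT => ?_, fun T hT => ?_⟩
  · obtain ⟨T, h1, h2⟩ := exists_preimage T₁ S₂
    exact ⟨T, tree_parallelJoin.2 (Or.inl ⟨h1 ▸ hT₁, h2 ▸ hS₂⟩)⟩
  · obtain ⟨T, h1, h2⟩ := exists_preimage S₁ S₂
    exact ⟨T, sep_parallelJoin.2 ⟨h1 ▸ hS₁, h2 ▸ hS₂⟩⟩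
  · rw [he, ncard_sdiff_sum hE hE']
    rcases tree_parallelJoin.1 hT with h | h
    · rw [ht _ h.1, hs' _ h.2, add_assoc]
    · rw [hs _ h.1, ht' _ h.2]
      omega
  · rw [he, ncard_sdiff_sum hE hE']
    have h := sep_parallelJoin.1 hT
    rw [hs _ h.1, hs' _ h.2]
    omega

lemma IsBalanced.seriesJoin {m n : ℕ} (hG : G.IsBalanced m) (hH : H.IsBalanced n) :
    (G.seriesJoin H).IsBalanced (m + n) := by
  obtain ⟨hE, ⟨T₁, hT₁⟩, ⟨S₁, hS₁⟩, ht, hs⟩ := hG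
  obtain ⟨hE', ⟨T₂, hT₂⟩, ⟨S₂, hS₂⟩, ht', hs'⟩ := hH
  have he : (G.seriesJoin H).edgeSet = Sum.inl '' G.edgeSet ∪ Sum.inr '' H.edgeSet := rfl
  refine ⟨he ▸ (hE.image _).union (hE'.image _), ?_, ?_, fun T hT => ?_, fun T hT => ?_⟩
  · obtain ⟨T, h1, h2⟩ := exists_preimage T₁ T₂
    exact ⟨T, tree_seriesJoin.2 ⟨h1 ▸ hT₁, h2 ▸ hT₂⟩⟩
  · obtain ⟨T, h1, h2⟩ := exists_preimage T₁ S₂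
    exact ⟨T, sep_seriesJoin.2 (Or.inl ⟨h1 ▸ hT₁, h2 ▸ hS₂⟩)⟩
  · rw [he, ncard_sdiff_sum hE hE']
    have h := tree_seriesJoin.1 hT
    rw [ht _ h.1, ht' _ h.2]
  · rw [he, ncard_sdiff_sum hE hE']
    rcases sep_seriesJoin.1 hT with h | h
    · rw [ht _ h.1, hs' _ h.2]
      omega
    · rw [hs _ h.1, ht' _ h.2]
      omega

lemma IsBalanced.iso {n : ℕ} (hG : G.IsBalanced n) (h : G.Iso H) : H.IsBalanced n := by
  obtain ⟨hE, ⟨T₁, hT₁⟩, ⟨S₁, hS₁⟩, ht, hs⟩ := hG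
  obtain ⟨f, g, hV, hE', hl, hso, hte⟩ := h
  have hI : IsIso G.toGraph H.toGraph f g := ⟨hV, hE', hl⟩
  have htree {T : Set β} (hT : T ⊆ G.edgeSet) : H.Tree (g '' T) ↔ G.Tree T :=
    hI.isSpanningTree_iff hT G.source_mem
  have hsep {T : Set β} (hT : T ⊆ G.edgeSet) : H.Sep (g '' T) ↔ G.Sep T := by
    rw [Sep, ← hso, ← hte]
    exact hI.isSep_iff hT G.source_mem G.terminal_mem
  have hex {T : Set β'} (hT : T ⊆ H.edgeSet) : ∃ S ⊆ G.edgeSet, g '' S = T :=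
    Set.subset_image_iff.1 (hT.trans hE'.image_eq.symm.subset)
  refine ⟨hE'.image_eq ▸ hE.image g, ⟨_, (htree hT₁.1).2 hT₁⟩, ⟨_, (hsep hS₁.1).2 hS₁⟩,
    fun T hT => ?_, fun T hT => ?_⟩
  · obtain ⟨S, hS, rfl⟩ := hex hT.1
    rw [hI.ncard_sdiff hS, ht _ ((htree hS).1 hT)]
  · obtain ⟨S, hS, rfl⟩ := hex hT.1
    rw [hI.ncard_sdiff hS, hs _ ((hsep hS).1 hT)]

/-- Structural induction replaces a rank formula for spanning trees: `n` is 0 for `K₂`, additive in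
series, and additive plus one in parallel. -/
lemma IsSeriesParallel.exists_isBalanced (hG : G.IsSeriesParallel) : ∃ n, G.IsBalanced n := by
  induction hG with
  | @k2 _ _ G h =>
    obtain ⟨hV, e, hE, hl⟩ := h
    refine ⟨0, by simp [hE], ⟨_, (tree_of_isK2 hV hE hl).2 rfl⟩, ⟨_, (sep_of_isK2 hV hE hl).2 rfl⟩,
      fun T hT => ?_, fun T hT => ?_⟩
    · rw [(tree_of_isK2 hV hE hl).1 hT, hE]
      simp
    · rw [(sep_of_isK2 hV hE hl).1 hT, hE]
      simp
  | parallel _ _ ih ih' =>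
    obtain ⟨m, hm⟩ := ih
    obtain ⟨n, hn⟩ := ih'
    exact ⟨_, hm.parallelJoin hn⟩
  | series _ _ ih ih' =>
    obtain ⟨m, hm⟩ := ih
    obtain ⟨n, hn⟩ := ih'
    exact ⟨_, hm.seriesJoin hn⟩
  | iso _ h ih =>
    obtain ⟨n, hn⟩ := ih
    exact ⟨n, hn.iso h⟩

lemma Tree.not_sep {T : Set β} (h : G.Tree T) : ¬ G.Sep T := fun h' =>
  h'.2.1.1 (((isSpanningTree_iff_of_mem G.source_mem).1 h).2.1 _ G.terminal_mem)

/-! ### Product formulas for the joins -/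

section Polynomials

variable [Fintype β] [Fintype β']

lemma psi_eq_treePoly (G : STGraph α β) : G.psi = treePoly G.edgeSet G.Tree :=
  kirchhoff_eq_treePoly _

lemma breaker_eq_treePoly (G : STGraph α β) : G.breaker = treePoly G.edgeSet G.Sep := by
  classical
  rw [breaker, kirchhoff_eq_treePoly]
  congr 1
  ext T
  exact isSpanningTree_breaker_iff G T

lemma psi_parallelJoin (G : STGraph α β) (H : STGraph α' β') : (G.parallelJoin H).psi =
    rename Sum.inl G.psi * rename Sum.inr H.breaker +
      rename Sum.inl G.breaker * rename Sum.inr H.psi := by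
  simp only [psi_eq_treePoly, breaker_eq_treePoly, ← treePoly_sum]
  rw [← treePoly_or _ fun T h h' => h.1.not_sep h'.1]
  congr 1
  ext T
  exact tree_parallelJoin

lemma breaker_parallelJoin (G : STGraph α β) (H : STGraph α' β') : (G.parallelJoin H).breaker =
    rename Sum.inl G.breaker * rename Sum.inr H.breaker := by
  simp only [breaker_eq_treePoly, ← treePoly_sum]
  congr 1
  ext T
  exact sep_parallelJoin

lemma psi_seriesJoin (G : STGraph α β) (H : STGraph α' β') : (G.seriesJoin H).psi =
    rename Sum.inl G.psi * rename Sum.inr H.psi := by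
  simp only [psi_eq_treePoly, ← treePoly_sum]
  congr 1
  ext T
  exact tree_seriesJoin

lemma breaker_seriesJoin (G : STGraph α β) (H : STGraph α' β') : (G.seriesJoin H).breaker =
    rename Sum.inl G.psi * rename Sum.inr H.breaker +
      rename Sum.inl G.breaker * rename Sum.inr H.psi := by
  simp only [psi_eq_treePoly, breaker_eq_treePoly, ← treePoly_sum]
  rw [← treePoly_or _ fun T h h' => h.1.not_sep h'.1]
  congr 1
  ext T
  exact sep_seriesJoin

lemma IsBalanced.isHomogeneous_psi {n : ℕ} (h : G.IsBalanced n) : G.psi.IsHomogeneous n := by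
  rw [psi_eq_treePoly]
  exact isHomogeneous_treePoly h.2.2.2.1

lemma IsBalanced.isHomogeneous_breaker {n : ℕ} (h : G.IsBalanced n) :
    G.breaker.IsHomogeneous (n + 1) := by
  rw [breaker_eq_treePoly]
  exact isHomogeneous_treePoly h.2.2.2.2

lemma IsBalanced.psi_ne_zero {n : ℕ} (h : G.IsBalanced n) : G.psi ≠ 0 := by
  rw [psi_eq_treePoly]
  exact treePoly_ne_zero h.2.1

end Polynomials

end STGraph

/-! ### From a simultaneous combination to the Jacobian ideal -/

section Algebra

variable {σ τ : Type v}

lemma pderiv_inl_rename_mul (j : σ) (a : MvPolynomial σ ℚ) (b : MvPolynomial τ ℚ) :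
    pderiv (Sum.inl j) (rename Sum.inl a * rename Sum.inr b) =
      rename Sum.inl (pderiv j a) * rename Sum.inr b := by
  classical
  rw [pderiv_mul, pderiv_rename Sum.inl_injective,
    pderiv_eq_zero_of_notMem_vars (f := rename Sum.inr b), mul_zero, add_zero]
  intro h
  have := vars_rename Sum.inr b h
  simp at this

lemma pderiv_inr_rename_mul (k : τ) (a : MvPolynomial σ ℚ) (b : MvPolynomial τ ℚ) :
    pderiv (Sum.inr k) (rename Sum.inl a * rename Sum.inr b) =
      rename Sum.inl a * rename Sum.inr (pderiv k b) := by
  classical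
  rw [pderiv_mul, pderiv_rename Sum.inr_injective,
    pderiv_eq_zero_of_notMem_vars (f := rename Sum.inl a), zero_mul, zero_add]
  intro h
  have := vars_rename Sum.inl a h
  simp at this

lemma mem_of_natCast_mul_mem {I : Ideal (MvPolynomial σ ℚ)} {n : ℕ} (hn : n ≠ 0)
    {p : MvPolynomial σ ℚ} (h : (n : MvPolynomial σ ℚ) * p ∈ I) : p ∈ I := by
  have h1 := I.mul_mem_left (C ((n : ℚ)⁻¹)) h
  rwa [← mul_assoc, ← map_natCast (C (R := ℚ) (σ := σ)), ← C_mul,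
    inv_mul_cancel₀ (Nat.cast_ne_zero.2 hn), C_1, one_mul] at h1

variable [Fintype σ] [Fintype τ]

/-- If the pairs `(a, b)` and `(a', b')` satisfy a simultaneous combination, then
`a f + b g` lies in the Jacobian ideal of `a' f + b' g` in disjoint sets of variables. -/
lemma mem_jacobianIdeal_of_combination {a b a' b' B D : MvPolynomial σ ℚ}
    {f g : MvPolynomial τ ℚ} {m n : ℕ} (ha : a'.IsHomogeneous m) (hb : b'.IsHomogeneous (m + 1))
    (hf : f.IsHomogeneous (n + 1)) (hg : g.IsHomogeneous n) (A : σ → MvPolynomial σ ℚ)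
    (h₁ : a = ∑ j, A j * pderiv j a' + B * a') (h₂ : b = ∑ j, A j * pderiv j b' + D * b') :
    rename Sum.inl a * rename Sum.inr f + rename Sum.inl b * rename Sum.inr g ∈
      Ideal.span (Set.range fun j : σ ⊕ τ => pderiv j
        (rename Sum.inl a' * rename Sum.inr f + rename Sum.inl b' * rename Sum.inr g)) := by
  set I := Ideal.span (Set.range fun j : σ ⊕ τ => pderiv j
        (rename Sum.inl a' * rename Sum.inr f + rename Sum.inl b' * rename Sum.inr g)) with hI
  have hl (j : σ) : rename Sum.inl (pderiv j a') * rename Sum.inr f +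
      rename Sum.inl (pderiv j b') * rename Sum.inr g ∈ I := by
    have : pderiv (Sum.inl j) (rename Sum.inl a' * rename Sum.inr f +
      rename Sum.inl b' * rename Sum.inr g) ∈ I := Ideal.subset_span ⟨Sum.inl j, rfl⟩
    rwa [map_add, pderiv_inl_rename_mul, pderiv_inl_rename_mul] at this
  have hr (k : τ) : rename Sum.inl a' * rename Sum.inr (pderiv k f) +
      rename Sum.inl b' * rename Sum.inr (pderiv k g) ∈ I := by
    have : pderiv (Sum.inr k) (rename Sum.inl a' * rename Sum.inr f +
      rename Sum.inl b' * rename Sum.inr g) ∈ I := Ideal.subset_span ⟨Sum.inr k, rfl⟩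
    rwa [map_add, pderiv_inr_rename_mul, pderiv_inr_rename_mul] at this
  set s : MvPolynomial (σ ⊕ τ) ℚ := rename Sum.inl a' * rename Sum.inr f with hs
  set t : MvPolynomial (σ ⊕ τ) ℚ := rename Sum.inl b' * rename Sum.inr g with ht
  have comb (A : σ → MvPolynomial σ ℚ) : rename Sum.inl (∑ j, A j * pderiv j a') *
      rename Sum.inr f + rename Sum.inl (∑ j, A j * pderiv j b') * rename Sum.inr g ∈ I := by
    have := I.sum_mem (t := Finset.univ) fun j _ => I.mul_mem_left (rename Sum.inl (A j)) (hl j)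
    convert! this using 1
    simp only [map_sum, map_mul, Finset.sum_mul, mul_add, Finset.sum_add_distrib, mul_assoc]
  have comb' (A : τ → MvPolynomial τ ℚ) : rename Sum.inl a' *
      rename Sum.inr (∑ j, A j * pderiv j f) + rename Sum.inl b' *
      rename Sum.inr (∑ j, A j * pderiv j g) ∈ I := by
    have := I.sum_mem (t := Finset.univ) fun j _ => I.mul_mem_left (rename Sum.inr (A j)) (hr j)
    convert! this using 1
    simp only [map_sum, map_mul, Finset.mul_sum, mul_add, Finset.sum_add_distrib, mul_left_comm]
  -- Coefficients `X` give Euler's identities: modulo `I`, `m s + (m + 1) t = 0` and `(n + 1) s + n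
  -- t = 0`. Their determinant is `-(m + n + 1)`, so `s` and `t` can be solved for.
  have e1 := comb X
  have e2 := comb' X
  rw [ha.sum_X_mul_pderiv, hb.sum_X_mul_pderiv] at e1
  rw [hf.sum_X_mul_pderiv, hg.sum_X_mul_pderiv] at e2
  simp only [nsmul_eq_mul, map_mul, map_natCast] at e1 e2
  have hs' : s ∈ I := by
    refine mem_of_natCast_mul_mem (n := m + n + 1) (by omega) ?_
    convert! I.sub_mem (I.mul_mem_left ((m : MvPolynomial (σ ⊕ τ) ℚ) + 1) e2)
      (I.mul_mem_left (n : MvPolynomial (σ ⊕ τ) ℚ) e1) using 1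
    push_cast
    ring
  have ht' : t ∈ I := by
    refine mem_of_natCast_mul_mem (n := m + n + 1) (by omega) ?_
    convert! I.sub_mem (I.mul_mem_left ((n : MvPolynomial (σ ⊕ τ) ℚ) + 1) e1)
      (I.mul_mem_left (m : MvPolynomial (σ ⊕ τ) ℚ) e2) using 1
    push_cast
    ring
  have := I.add_mem (I.add_mem (comb A) (I.mul_mem_left (rename Sum.inl B) hs'))
    (I.mul_mem_left (rename Sum.inl D) ht')
  convert! this using 1
  conv_lhs => rw [h₁, h₂]
  simp only [map_add, map_mul]
  ring

end Algebra

/-! ### Comparison of coefficients for the test graph -/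

section Coefficients

variable {R : Type u} [CommRing R]

/-- The exponent vector with the given four entries. -/
noncomputable def expo (a b c d : ℕ) : Fin 4 →₀ ℕ := Finsupp.equivFunOnFinite.symm ![a, b, c, d]

lemma expo_le (a b c d a' b' c' d' : ℕ) :
    expo a b c d ≤ expo a' b' c' d' ↔ a ≤ a' ∧ b ≤ b' ∧ c ≤ c' ∧ d ≤ d' := by
  simp [Finsupp.le_def, expo, Fin.forall_fin_succ]

lemma expo_sub (a b c d a' b' c' d' : ℕ) :
    expo a b c d - expo a' b' c' d' = expo (a - a') (b - b') (c - c') (d - d') := by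
  ext i
  fin_cases i <;> simp [expo]

lemma expo_inj (a b c d a' b' c' d' : ℕ) :
    expo a b c d = expo a' b' c' d' ↔ a = a' ∧ b = b' ∧ c = c' ∧ d = d' := by
  simp [expo]

lemma monomial_expo (a b c d : ℕ) (r : R) :
    monomial (expo a b c d) r = C r * (X 0 ^ a * X 1 ^ b * X 2 ^ c * X 3 ^ d) := by
  rw [monomial_eq, Finsupp.prod_fintype _ _ (by simp)]
  simp [expo, Fin.prod_univ_four]

lemma coeff_mul_monomial_expo (a b c d a' b' c' d' : ℕ) (p : MvPolynomial (Fin 4) R) (r : R) :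
    coeff (expo a b c d) (p * monomial (expo a' b' c' d') r) =
      if a' ≤ a ∧ b' ≤ b ∧ c' ≤ c ∧ d' ≤ d then
        coeff (expo (a - a') (b - b') (c - c') (d - d')) p * r else 0 := by
  simp only [coeff_mul_monomial', expo_le, expo_sub]

lemma coeff_monomial_expo (a b c d a' b' c' d' : ℕ) (r : R) :
    coeff (expo a b c d) (monomial (expo a' b' c' d') r) =
      if a' = a ∧ b' = b ∧ c' = c ∧ d' = d then r else 0 := by
  classical
  simp only [coeff_monomial, expo_inj]

/-- Comparison of coefficients in a combination of the partial derivatives for two double edges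
in series; the variables `X 0, X 1` are half the sum and half the difference of the edge variables
of the first double edge, and `X 2, X 3` those of the second one. -/
lemma combination_of_coeff [IsDomain R] {a b a' b' : R} (ha' : a' ≠ 0)
    {U V K L M N : MvPolynomial (Fin 4) R}
    (h : C a * (2 * (X 0 ^ 2 - X 1 ^ 2) * X 2 + 2 * X 0 * (X 2 ^ 2 - X 3 ^ 2)) +
        C b * (4 * X 0 * X 2) =
      U * (2 * (X 0 ^ 2 - X 1 ^ 2) * X 2 + 2 * X 0 * (X 2 ^ 2 - X 3 ^ 2)) + V * (4 * X 0 * X 2) +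
      K * (C a' * (2 * X 0 * X 2 + X 2 ^ 2 - X 3 ^ 2) + C b' * (2 * X 2)) +
      L * (C a' * (2 * X 1 * X 2)) +
      M * (C a' * (2 * X 0 * X 2 + X 0 ^ 2 - X 1 ^ 2) + C b' * (2 * X 0)) +
      N * (C a' * (2 * X 0 * X 3))) :
    ∃ B D : R, 4 * a = 4 * coeff 0 U + B * a' ∧ 4 * b = 4 * coeff 0 V + D * b' := by
  have h0 : expo 0 0 0 0 = 0 := by
    ext i
    fin_cases i <;> simp [expo]
  have h' : monomial (expo 2 0 1 0) (2 * a) - monomial (expo 0 2 1 0) (2 * a) +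
      monomial (expo 1 0 2 0) (2 * a) - monomial (expo 1 0 0 2) (2 * a) +
      monomial (expo 1 0 1 0) (4 * b) =
      U * monomial (expo 2 0 1 0) 2 - U * monomial (expo 0 2 1 0) 2 +
      U * monomial (expo 1 0 2 0) 2 - U * monomial (expo 1 0 0 2) 2 +
      V * monomial (expo 1 0 1 0) 4 +
      K * monomial (expo 1 0 1 0) (2 * a') + K * monomial (expo 0 0 2 0) a' -
      K * monomial (expo 0 0 0 2) a' + K * monomial (expo 0 0 1 0) (2 * b') +
      L * monomial (expo 0 1 1 0) (2 * a') +
      M * monomial (expo 1 0 1 0) (2 * a') + M * monomial (expo 2 0 0 0) a' -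
      M * monomial (expo 0 2 0 0) a' + M * monomial (expo 1 0 0 0) (2 * b') +
      N * monomial (expo 1 0 0 1) (2 * a') := by
    simp only [monomial_expo, map_mul, map_ofNat]
    linear_combination h
  -- `k1` and `k2` belong to monomials of `P_H` and carry `a`; `k4` belongs to the monomial of `Ψ_H`
  -- and carries `b`. The unwanted multiples of `b'` in `k1 + k2` cancel by `k3`, and those of `a'`
  -- in `k4` vanish by `k5` and `k6`.
  have k1 := congrArg (coeff (expo 0 2 1 0)) h'
  have k2 := congrArg (coeff (expo 1 0 0 2)) h'
  have k3 := congrArg (coeff (expo 0 2 0 2)) h'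
  have k4 := congrArg (coeff (expo 1 0 1 0)) h'
  have k5 := congrArg (coeff (expo 0 2 0 0)) h'
  have k6 := congrArg (coeff (expo 0 0 0 2)) h'
  clear h h'
  simp only [coeff_add, coeff_sub, coeff_mul_monomial_expo, coeff_monomial_expo] at k1 k2 k3 k4 k5 k6
  norm_num [h0] at k1 k2 k3 k4 k5 k6
  have hM := k5.resolve_right ha'
  have hK := k6.resolve_right ha'
  have hKM : coeff (expo 0 2 0 0) K + coeff (expo 0 0 0 2) M = 0 :=
    (mul_eq_zero.1 (by linear_combination k3)).resolve_right ha'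
  refine ⟨coeff (expo 0 0 1 0) M + coeff (expo 1 0 0 0) K - 2 * coeff (expo 0 1 0 0) L -
    2 * coeff (expo 0 0 0 1) N, 2 * (coeff (expo 1 0 0 0) K + coeff (expo 0 0 1 0) M), ?_, ?_⟩
  · linear_combination -k1 - k2 - 2 * b' * hKM
  · linear_combination k4 + 2 * a' * hM + 2 * a' * hK

end Coefficients

/-! ### The test graph and the two implications -/

namespace STGraph

/-- The graph `K₂`. -/
def edgeGraph : STGraph (ULift.{u} Bool) PUnit.{v + 1} where
  vertexSet := Set.univ
  edgeSet := Set.univ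
  IsLink _ x y := x ≠ y
  isLink_symm := fun _ _ => ⟨fun _ _ h => h.symm⟩
  eq_or_eq_of_isLink_of_isLink := by
    rintro _ ⟨_ | _⟩ ⟨_ | _⟩ ⟨_ | _⟩ ⟨_ | _⟩ <;> simp
  edge_mem_iff_exists_isLink := fun _ => ⟨fun _ => ⟨⟨false⟩, ⟨true⟩, by simp⟩, fun _ => trivial⟩
  left_mem_of_isLink := fun _ _ _ _ => trivial
  source := ⟨false⟩
  terminal := ⟨true⟩
  source_mem := trivial
  terminal_mem := trivial
  source_ne_terminal := by simp

lemma vertexSet_edgeGraph : edgeGraph.{u, v}.vertexSet =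
    {edgeGraph.{u, v}.source, edgeGraph.{u, v}.terminal} := by
  refine (Set.eq_univ_of_forall ?_).symm
  rintro ⟨_ | _⟩
  · exact Or.inl rfl
  · exact Or.inr rfl

lemma edgeSet_edgeGraph : edgeGraph.{u, v}.edgeSet = {PUnit.unit} :=
  (Set.eq_univ_of_forall fun _ => rfl).symm

lemma isLink_edgeGraph : edgeGraph.{u, v}.IsLink PUnit.unit edgeGraph.{u, v}.source
    edgeGraph.{u, v}.terminal := edgeGraph.source_ne_terminal

lemma isSeriesParallel_edgeGraph : edgeGraph.{u, v}.IsSeriesParallel :=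
  .k2 ⟨vertexSet_edgeGraph.{u, v}, _, edgeSet_edgeGraph.{u, v}, isLink_edgeGraph.{u, v}⟩

lemma tree_edgeGraph (T : Set PUnit.{v + 1}) : edgeGraph.{u, v}.Tree T ↔ T = {PUnit.unit} :=
  tree_of_isK2 vertexSet_edgeGraph.{u, v} edgeSet_edgeGraph.{u, v} isLink_edgeGraph.{u, v}

lemma sep_edgeGraph (T : Set PUnit.{v + 1}) : edgeGraph.{u, v}.Sep T ↔ T = ∅ :=
  sep_of_isK2 vertexSet_edgeGraph.{u, v} edgeSet_edgeGraph.{u, v} isLink_edgeGraph.{u, v}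

lemma sum_finset_punit {M : Type*} [AddCommMonoid M] (f : Finset PUnit.{v + 1} → M) :
    ∑ T, f T = f ∅ + f {PUnit.unit} := by
  rw [show (Finset.univ : Finset (Finset PUnit.{v + 1})) = {∅, {PUnit.unit}} from rfl]
  exact Finset.sum_pair (by simp)

lemma psi_edgeGraph : edgeGraph.{u, v}.psi = 1 := by
  classical
  rw [psi_eq_treePoly, treePoly, sum_finset_punit]
  simp [tree_edgeGraph, Set.ext_iff]

lemma breaker_edgeGraph : edgeGraph.{u, v}.breaker = X PUnit.unit := by
  classical
  rw [breaker_eq_treePoly, treePoly, sum_finset_punit]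
  simp [sep_edgeGraph, edgeSet_edgeGraph.{u, v}]

/-- Two double edges in series. -/
noncomputable def doubleDigon := (edgeGraph.{u, v}.parallelJoin edgeGraph.{u, v}).seriesJoin
  (edgeGraph.{u, v}.parallelJoin edgeGraph.{u, v})

lemma isSeriesParallel_doubleDigon : doubleDigon.{u, v}.IsSeriesParallel :=
  .series (.parallel isSeriesParallel_edgeGraph isSeriesParallel_edgeGraph)
    (.parallel isSeriesParallel_edgeGraph isSeriesParallel_edgeGraph)

lemma psi_doubleDigon : doubleDigon.{u, v}.psi =
    (X (Sum.inl (Sum.inl PUnit.unit)) + X (Sum.inl (Sum.inr PUnit.unit))) *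
    (X (Sum.inr (Sum.inl PUnit.unit)) + X (Sum.inr (Sum.inr PUnit.unit))) := by
  rw [doubleDigon, psi_seriesJoin, psi_parallelJoin, psi_edgeGraph, breaker_edgeGraph]
  simp only [map_one, rename_X, map_add, map_mul]
  ring

lemma breaker_doubleDigon : doubleDigon.{u, v}.breaker =
    (X (Sum.inl (Sum.inl PUnit.unit)) + X (Sum.inl (Sum.inr PUnit.unit))) *
      (X (Sum.inr (Sum.inl PUnit.unit)) * X (Sum.inr (Sum.inr PUnit.unit))) +
    X (Sum.inl (Sum.inl PUnit.unit)) * X (Sum.inl (Sum.inr PUnit.unit)) *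
      (X (Sum.inr (Sum.inl PUnit.unit)) + X (Sum.inr (Sum.inr PUnit.unit))) := by
  rw [doubleDigon, breaker_seriesJoin, psi_parallelJoin, breaker_parallelJoin, psi_edgeGraph,
    breaker_edgeGraph]
  simp only [map_one, rename_X, map_add, map_mul]
  ring

variable {α α' : Type u} {β β' : Type v} [Fintype β] [Fintype β']

lemma condition1_parallelJoin_iff {G : STGraph α β} (H : STGraph α' β') {e : β}
    (he : e ∈ G.edgeSet) : Condition1 (G.parallelJoin H).toGraph (Sum.inl e) ↔
      rename Sum.inl G.psi * rename Sum.inr H.breaker +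
        rename Sum.inl G.breaker * rename Sum.inr H.psi ∈
      Ideal.span (Set.range fun j : β ⊕ β' => pderiv j
        (rename Sum.inl (pderiv e G.psi) * rename Sum.inr H.breaker +
          rename Sum.inl (pderiv e G.breaker) * rename Sum.inr H.psi)) := by
  rw [Condition1, kirchhoff_deleteEdges _ (Or.inl ⟨e, he, rfl⟩), jacobianIdeal]
  change (G.parallelJoin H).psi ∈ Ideal.span (Set.range fun j => pderiv j (pderiv (Sum.inl e)
    (G.parallelJoin H).psi)) ↔ _
  simp only [psi_parallelJoin, map_add, pderiv_inl_rename_mul]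

/-- Otherwise the Jacobian ideal is zero and condition 1 forces `Ψ_G = 0`, although `G` has a
spanning tree. -/
lemma pderiv_psi_ne_zero {G : STGraph α β} (hG : G.IsSeriesParallel) {e : β}
    (he : e ∈ G.edgeSet) (h1 : Condition1 G.toGraph e) : pderiv e G.psi ≠ 0 := by
  intro h0
  obtain ⟨n, hn⟩ := hG.exists_isBalanced
  rw [Condition1, kirchhoff_deleteEdges _ he, show kirchhoff G.toGraph = G.psi from rfl, h0,
    jacobianIdeal, Ideal.span_eq_bot.2 (by simp), Ideal.mem_bot] at h1
  exact hn.psi_ne_zero h1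

lemma SimultaneousCombination.condition1 {G : STGraph α β} {H : STGraph α' β'} {e : β}
    (hG : G.IsSeriesParallel) (hH : H.IsSeriesParallel) (he : e ∈ G.edgeSet)
    (h0 : pderiv e G.psi ≠ 0) (h : G.SimultaneousCombination e) :
    Condition1 (G.parallelJoin H).toGraph (Sum.inl e) := by
  obtain ⟨m, hm⟩ := hG.exists_isBalanced
  obtain ⟨n, hn⟩ := hH.exists_isBalanced
  obtain ⟨A, B, D, h₁, h₂⟩ := h
  -- Positive degree of `Ψ_G` keeps the truncated subtraction in the degree of a derivative honest:
  -- `∂_eΨ_G` and `∂_eP_G` then differ in degree by one.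
  have hm0 : m ≠ 0 := by
    rintro rfl
    have := hm.isHomogeneous_psi
    rw [← totalDegree_zero_iff_isHomogeneous, totalDegree_eq_zero_iff_eq_C] at this
    exact h0 (by rw [this, pderiv_C])
  obtain ⟨m, rfl⟩ := Nat.exists_eq_succ_of_ne_zero hm0
  rw [condition1_parallelJoin_iff H he]
  exact mem_jacobianIdeal_of_combination hm.isHomogeneous_psi.pderiv
    hm.isHomogeneous_breaker.pderiv hn.isHomogeneous_breaker hn.isHomogeneous_psi A h₁ h₂

lemma simultaneousCombination_of_condition1 {G : STGraph α β} {e : β} (he : e ∈ G.edgeSet)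
    (h0 : pderiv e G.psi ≠ 0)
    (h : Condition1 (G.parallelJoin doubleDigon.{u, v}).toGraph (Sum.inl e)) :
    G.SimultaneousCombination e := by
  classical
  rw [condition1_parallelJoin_iff _ he, Ideal.mem_span_range_iff_exists_fun] at h
  obtain ⟨c, hc⟩ := h
  simp only [Fintype.sum_sum_type, Fintype.sum_unique, map_add, pderiv_inl_rename_mul,
    pderiv_inr_rename_mul] at hc
  -- In half sums and half differences, `Ψ_H` becomes the monomial `4 X₀ X₂`, and `X₁`, `X₃` enter
  -- `P_H` only through their squares.
  let y : (PUnit.{v + 1} ⊕ PUnit.{v + 1}) ⊕ (PUnit.{v + 1} ⊕ PUnit.{v + 1}) →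
      MvPolynomial (Fin 4) (MvPolynomial β ℚ) :=
    Sum.elim (Sum.elim (fun _ => X 0 + X 1) fun _ => X 0 - X 1)
      (Sum.elim (fun _ => X 2 + X 3) fun _ => X 2 - X 3)
  let φ : MvPolynomial (β ⊕ _) ℚ →ₐ[ℚ] MvPolynomial (Fin 4) (MvPolynomial β ℚ) :=
    aeval (Sum.elim (fun j => C (X j)) y)
  have hl (p : MvPolynomial β ℚ) : φ (rename Sum.inl p) = C p := by
    have : (φ.comp (rename Sum.inl)) =
        IsScalarTower.toAlgHom ℚ (MvPolynomial β ℚ) (MvPolynomial (Fin 4) (MvPolynomial β ℚ)) := by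
      ext j
      simp [φ]
    exact DFunLike.congr_fun this p
  have hr (k) : φ (X (Sum.inr k)) = y k := by simp [φ]
  have hφ := congrArg φ hc
  rw [psi_doubleDigon, breaker_doubleDigon] at hφ
  simp only [map_add, map_mul, map_sum, hl, hr, rename_X, pderiv_mul, pderiv_X, Pi.single_apply,
    reduceCtorEq, Sum.inl.injEq, Sum.inr.injEq, if_true, if_false, map_one, map_zero,
    PUnit.default_eq_unit, y, Sum.elim_inl, Sum.elim_inr] at hφ
  set ca := φ (c (Sum.inr (Sum.inl (Sum.inl PUnit.unit))))
  set cb := φ (c (Sum.inr (Sum.inl (Sum.inr PUnit.unit))))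
  set cc := φ (c (Sum.inr (Sum.inr (Sum.inl PUnit.unit))))
  set cd := φ (c (Sum.inr (Sum.inr (Sum.inr PUnit.unit))))
  -- `U` and `V` are built from the same coefficients `c (Sum.inl j)`, which is why both identities
  -- end up with the same `A_j`. `K, L, M, N` regroup the coefficients of each double edge by sum
  -- and difference.
  obtain ⟨B, D, h1, h2⟩ := combination_of_coeff h0 (a := G.psi) (b := G.breaker)
    (b' := pderiv e G.breaker)
    (U := ∑ j, φ (c (Sum.inl j)) * C (pderiv j (pderiv e G.psi)))
    (V := ∑ j, φ (c (Sum.inl j)) * C (pderiv j (pderiv e G.breaker)))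
    (K := ca + cb) (L := cb - ca) (M := cc + cd) (N := cd - cc) (by
      simp only [mul_add, ← mul_assoc, Finset.sum_add_distrib, ← Finset.sum_mul] at hφ
      linear_combination -hφ)
  have h4 : (4 : MvPolynomial β ℚ) * C (1 / 4) = 1 := by
    rw [← map_ofNat C, ← C_mul]
    norm_num
  have hk (p : β → MvPolynomial β ℚ) : coeff 0 (∑ j, φ (c (Sum.inl j)) * C (p j)) =
      ∑ j, coeff 0 (φ (c (Sum.inl j))) * p j := by
    rw [coeff_sum]
    exact Finset.sum_congr rfl fun j _ => by rw [mul_comm, coeff_C_mul, mul_comm]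
  rw [hk] at h1 h2
  -- `A_j` is the coefficient of `∂_jF` with the variables of the test graph set to zero.
  refine ⟨fun j => coeff 0 (φ (c (Sum.inl j))), C (1 / 4) * B, C (1 / 4) * D, ?_, ?_⟩
  · linear_combination C (1 / 4) * h1 - (G.psi - ∑ j, coeff 0 (φ (c (Sum.inl j))) *
      pderiv j (pderiv e G.psi)) * h4
  · linear_combination C (1 / 4) * h2 - (G.breaker - ∑ j, coeff 0 (φ (c (Sum.inl j))) *
      pderiv j (pderiv e G.breaker)) * h4

end STGraph

end Kirchhoff

theorem mainTheorem7 {α : Type u} {β : Type v} [Fintype β] (G : Kirchhoff.STGraph α β) (e : β)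
    (hG : G.IsSeriesParallel) (he : e ∈ G.edgeSet)
    (h1 : Kirchhoff.Condition1 G.toGraph e) :
    (¬ G.SimultaneousCombination e →
      ∃ (α' : Type u) (β' : Type v) (_ : Fintype β') (H : Kirchhoff.STGraph α' β'),
        H.IsSeriesParallel ∧
          ¬ Kirchhoff.Condition1 (G.parallelJoin H).toGraph (Sum.inl e)) ∧
    (G.SimultaneousCombination e ↔
      ∀ (α' : Type u) (β' : Type v) [Fintype β'] (H : Kirchhoff.STGraph α' β'),
        H.IsSeriesParallel →
          Kirchhoff.Condition1 (G.parallelJoin H).toGraph (Sum.inl e)) := by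
  have h0 := Kirchhoff.STGraph.pderiv_psi_ne_zero hG he h1
  refine ⟨fun hS => ⟨_, _, inferInstance, _, Kirchhoff.STGraph.isSeriesParallel_doubleDigon,
    fun h => hS (Kirchhoff.STGraph.simultaneousCombination_of_condition1 he h0 h)⟩,
    fun hS α' β' _ H hH => hS.condition1 hG hH he h0, fun h => ?_⟩
  exact Kirchhoff.STGraph.simultaneousCombination_of_condition1 he h0
    (h _ _ _ Kirchhoff.STGraph.isSeriesParallel_doubleDigon)
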